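/- Let $n \ge 1$ and let $\mathbb{CP}^n$ be the complex projective space of complex dimension $n$, regarded as a smooth real manifold of dimension $2n$. Let $M \subset \mathbb{CP}^n$ be a smooth ($C^\infty$) closed connected real hypersurface; that is, $M$ is a compact, connected, nonempty subset such that every point $p \in M$ has an open neighbourhood $U \subset \mathbb{CP}^n$ and a $C^\infty$ function $\rho : U \to \mathbb{R}$ with $d\rho \neq 0$ at every point of $U$ and $M \cap U = \{q \in U : \rho(q) = 0\}$. Then the $(2n-1)$-dimensional manifold $M$ is orientable, and the complement $\mathbb{CP}^n \setminus M$ has exactly two connected components. -/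

import Mathlib

open scoped Manifold ContDiff LinearAlgebra.Projectivization

/-! ### Complex projective space as a smooth manifold -/

/-- The complex projective space of complex dimension `n`: the space of complex lines in
`ℂ^(n+1)`. -/
def CP (n : ℕ) : Type := ℙ ℂ (Fin (n + 1) → ℂ)

namespace CP

variable {n : ℕ}

/-- The canonical projection from the nonzero vectors of `ℂ^(n+1)`, i.e. the point with the
homogeneous coordinates `v`. -/
noncomputable def proj (v : {v : Fin (n + 1) → ℂ // v ≠ 0}) : CP n := Projectivization.mk' ℂ v

/-- The quotient topology. -/
noncomputable instance instTopologicalSpace : TopologicalSpace (CP n) :=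
  TopologicalSpace.coinduced (proj (n := n)) inferInstance

theorem proj_surjective : Function.Surjective (proj (n := n)) := by
  intro p
  induction p using Projectivization.ind with
  | h v hv => exact ⟨⟨v, hv⟩, rfl⟩

theorem isQuotientMap_proj : Topology.IsQuotientMap (proj (n := n)) :=
  ⟨⟨rfl⟩, proj_surjective⟩

theorem proj_eq_iff (v w : {v : Fin (n + 1) → ℂ // v ≠ 0}) :
    proj v = proj w ↔ ∃ a : ℂ, a • w.1 = v.1 :=
  Projectivization.mk_eq_mk_iff' ℂ v.1 w.1 v.2 w.2

/-- The affine coordinates `(z_j / z_i)_{j ≠ i}` of the point `[z_0 : ⋯ : z_n]`. -/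
noncomputable def affineCoord (i : Fin (n + 1)) : CP n → (Fin n → ℂ) :=
  Projectivization.lift
    (fun v : {v : Fin (n + 1) → ℂ // v ≠ 0} => fun j : Fin n => v.1 (i.succAbove j) / v.1 i) <| by
    intro a b t h
    have ht : t ≠ 0 := by
      rintro rfl
      exact a.2 (by simpa using h)
    funext j
    simp only [h, Pi.smul_apply, smul_eq_mul]
    exact mul_div_mul_left _ _ ht

theorem affineCoord_proj (i : Fin (n + 1)) (v : {v : Fin (n + 1) → ℂ // v ≠ 0}) (j : Fin n) :
    affineCoord i (proj v) j = v.1 (i.succAbove j) / v.1 i := rfl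

theorem insertNth_ne_zero (i : Fin (n + 1)) (w : Fin n → ℂ) :
    (i.insertNth (1 : ℂ) w : Fin (n + 1) → ℂ) ≠ 0 := by
  intro h
  have := congrFun h i
  simp at this

/-- The point with homogeneous coordinate `1` in place `i` and the remaining homogeneous
coordinates `w`. -/
noncomputable def ofAffine (i : Fin (n + 1)) (w : Fin n → ℂ) : CP n :=
  proj ⟨i.insertNth (1 : ℂ) w, insertNth_ne_zero i w⟩

/-- The affine domain `{z_i ≠ 0}`. -/
def affineDomain (i : Fin (n + 1)) : Set (CP n) :=
  {p | ∃ v : {v : Fin (n + 1) → ℂ // v ≠ 0}, proj v = p ∧ v.1 i ≠ 0}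

theorem proj_mem_affineDomain (i : Fin (n + 1)) (v : {v : Fin (n + 1) → ℂ // v ≠ 0}) :
    proj v ∈ affineDomain i ↔ v.1 i ≠ 0 := by
  refine ⟨?_, fun h => ⟨v, rfl, h⟩⟩
  rintro ⟨w, hw, hi⟩ h0
  obtain ⟨a, ha⟩ := (proj_eq_iff w v).1 hw
  apply hi
  rw [← ha, Pi.smul_apply, h0, smul_zero]

theorem isOpen_affineDomain (i : Fin (n + 1)) : IsOpen (affineDomain (n := n) i) := by
  rw [← isQuotientMap_proj.isOpen_preimage]
  have : proj ⁻¹' affineDomain i = {v : {v : Fin (n + 1) → ℂ // v ≠ 0} | v.1 i ≠ 0} := by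
    ext v
    exact proj_mem_affineDomain i v
  rw [this]
  exact isOpen_ne_fun ((continuous_apply i).comp continuous_subtype_val) continuous_const

/-- The standard affine chart `[z_0 : ⋯ : z_n] ↦ (z_j / z_i)_{j ≠ i}` on `{z_i ≠ 0}`. -/
noncomputable def affineChart (i : Fin (n + 1)) : OpenPartialHomeomorph (CP n) (Fin n → ℂ) where
  toFun := affineCoord i
  invFun := ofAffine i
  source := affineDomain i
  target := Set.univ
  map_source' _ _ := Set.mem_univ _
  map_target' w _ := (proj_mem_affineDomain i _).2 (by simp)
  left_inv' := by
    rintro _ ⟨v, rfl, hi⟩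
    refine (proj_eq_iff _ _).2 ⟨(v.1 i)⁻¹, ?_⟩
    funext k
    refine Fin.succAboveCases i ?_ (fun j => ?_) k
    · simp [hi]
    · simp [affineCoord_proj, div_eq_inv_mul]
  right_inv' w _ := by
    funext j
    simp [ofAffine, affineCoord_proj]
  open_source := isOpen_affineDomain i
  open_target := isOpen_univ
  continuousOn_toFun := by
    rw [isQuotientMap_proj.continuousOn_isOpen_iff (isOpen_affineDomain i)]
    refine continuousOn_pi.2 fun j => ?_
    refine ContinuousOn.div (f := fun v : {v : Fin (n + 1) → ℂ // v ≠ 0} => v.1 (i.succAbove j))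
      (g := fun v => v.1 i) ((continuous_apply _).comp continuous_subtype_val).continuousOn
      ((continuous_apply _).comp continuous_subtype_val).continuousOn ?_
    intro v hv
    exact (proj_mem_affineDomain i v).1 hv
  continuousOn_invFun := by
    refine Continuous.continuousOn ?_
    refine isQuotientMap_proj.continuous.comp (Continuous.subtype_mk ?_ _)
    exact Continuous.finInsertNth i continuous_const continuous_id

theorem exists_mem_affineDomain (p : CP n) : ∃ i : Fin (n + 1), p ∈ affineDomain i := by
  obtain ⟨v, rfl⟩ := proj_surjective p
  obtain ⟨i, hi⟩ := Function.ne_iff.1 v.2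
  exact ⟨i, v, rfl, hi⟩

/-- The standard atlas, consisting of the `n + 1` affine charts. -/
noncomputable instance instChartedSpace : ChartedSpace (Fin n → ℂ) (CP n) where
  atlas := Set.range affineChart
  chartAt p := affineChart (exists_mem_affineDomain p).choose
  mem_chart_source p := (exists_mem_affineDomain p).choose_spec
  chart_mem_atlas _ := Set.mem_range_self _

/-- The standard atlas makes `CP n` a smooth real manifold. -/
instance instIsManifold : IsManifold 𝓘(ℝ, Fin n → ℂ) ∞ (CP n) := by
  refine isManifold_of_contDiffOn _ _ _ ?_
  rintro _ _ ⟨i, rfl⟩ ⟨k, rfl⟩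
  simp only [modelWithCornersSelf_coe, modelWithCornersSelf_coe_symm, Function.comp_id,
    Function.id_comp, Set.preimage_id, Set.range_id, Set.inter_univ]
  have hins : ∀ l : Fin (n + 1),
      ContDiff ℝ ∞ (fun w : Fin n → ℂ => (i.insertNth (1 : ℂ) w : Fin (n + 1) → ℂ) l) := by
    intro l
    refine Fin.succAboveCases i ?_ (fun j => ?_) l
    · simpa using contDiff_const
    · simpa using contDiff_apply ℝ ℂ j
  refine contDiffOn_pi.2 fun j => ?_
  refine ContDiffOn.congr
    (f := fun w : Fin n → ℂ => (i.insertNth (1 : ℂ) w : Fin (n + 1) → ℂ) (k.succAbove j) *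
      ((i.insertNth (1 : ℂ) w : Fin (n + 1) → ℂ) k)⁻¹)
    ((hins _).contDiffOn.mul ((hins _).contDiffOn.inv ?_)) fun w _ => div_eq_mul_inv _ _
  intro w hw
  rw [OpenPartialHomeomorph.trans_source] at hw
  exact (proj_mem_affineDomain k _).1 hw.2

end CP

/-! ### Smooth real hypersurfaces and orientability -/

section Submanifolds

variable {E H X : Type*} [NormedAddCommGroup E] [NormedSpace ℝ E] [TopologicalSpace H]
  (I : ModelWithCorners ℝ E H) [TopologicalSpace X] [ChartedSpace H X]

/-- `M` is a smooth real hypersurface of the manifold `X`: near each of its points it is the zero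
locus of a smooth real-valued function with nowhere vanishing differential. -/
def IsSmoothRealHypersurface (M : Set X) : Prop :=
  ∀ p ∈ M, ∃ (U : Set X) (ρ : X → ℝ), IsOpen U ∧ p ∈ U ∧
    ContMDiffOn I 𝓘(ℝ, ℝ) ∞ ρ U ∧
    (∀ q ∈ U, mfderiv I 𝓘(ℝ, ℝ) ρ q ≠ 0) ∧
    M ∩ U = {q ∈ U | ρ q = 0}

/-- `φ` is a smooth chart, with values in `ℝ^m`, of the embedded submanifold `M` of `X`: a
homeomorphism from an open subset of `M` (with the subspace topology) onto an open subset of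
`ℝ^m`, whose inverse is a smooth immersion into `X`. -/
def IsSubmanifoldChart {m : ℕ} {M : Set X}
    (φ : OpenPartialHomeomorph M (EuclideanSpace ℝ (Fin m))) : Prop :=
  ContMDiffOn 𝓘(ℝ, EuclideanSpace ℝ (Fin m)) I ∞ (fun y => (φ.symm y : X)) φ.target ∧
    ∀ y ∈ φ.target, Function.Injective
      (mfderiv 𝓘(ℝ, EuclideanSpace ℝ (Fin m)) I (fun y => (φ.symm y : X)) y)

/-- The embedded `m`-dimensional submanifold `M` of `X` is orientable: it has an atlas of smooth
charts all of whose transition maps have positive Jacobian determinant. -/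
def IsOrientableSubmanifold (m : ℕ) (M : Set X) : Prop :=
  ∃ A : Set (OpenPartialHomeomorph M (EuclideanSpace ℝ (Fin m))),
    (∀ φ ∈ A, IsSubmanifoldChart I φ) ∧
    (∀ p : M, ∃ φ ∈ A, p ∈ φ.source) ∧
    ∀ φ ∈ A, ∀ ψ ∈ A, ∀ y ∈ (φ.symm.trans ψ).source,
      0 < (fderiv ℝ (φ.symm.trans ψ) y).det

end Submanifolds

/-! Near a point of `M` the complement has two local sides, so there are exactly two germs of
functions with values ±1 off `M` and 0 on `M` that change sign across `M`; off `M` there are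
likewise two locally constant germs ±1. These germs form a double cover of projective space
(`sideCore`). The cover is trivial: each affine chart is simply connected, all of them contain `[1 :
⋯ : 1]`, and their pairwise intersections are connected, so the lifts of the charts through one
fixed germ at that point glue to a section (`exists_isSideOn_univ`). A section is a global side
function `σ`.

The complement is the union of `{σ = 1}` and `{σ = -1}`. Both are nonempty, since both signs occur
next to `M`. Each is connected, since a splitting of it would either split the connected set `M` or
produce a proper nonempty clopen subset of projective space (`IsSideOn.isPreconnected_side`).

For orientability, the inverse function theorem gives coordinates in which `M` is the zero set of
the first one. These are normalized so that the first coordinate has the sign of `σ` and the whole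
system agrees with the complex orientation (`CP.exists_isAdapted`). Along `M` the Jacobian of a
transition is then block triangular with positive determinant, and its normal entry is nonnegative
because sides are preserved; so the tangential block, the Jacobian of the transition on `M`, has
positive determinant. -/

open Set Filter Topology

/-! ### Side functions of a subset -/

section Sides

variable {X : Type*} [TopologicalSpace X] {M U V : Set X} {σ τ : X → SignType} {x : X}

/-- A function `σ` with values in `{-1, 0, 1}` which on the open set `U` vanishes exactly on `M`,
is locally constant off `M`, and takes both signs arbitrarily close to each point of `M`. -/
structure IsSideOn (M U : Set X) (σ : X → SignType) : Prop where
  isOpen : IsOpen U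
  zero_iff : ∀ y ∈ U, σ y = 0 ↔ y ∈ M
  continuousOn : ContinuousOn σ (U \ M)
  mem_closure : ∀ y ∈ U, y ∈ M → ∀ ε : SignTypeˣ, y ∈ closure {z | σ z = ε}

/-- Near `x`, the complement of `M` is the union of two preconnected sets, as small as desired. -/
def TwoSidedAt (M : Set X) (x : X) : Prop :=
  ∀ V ∈ 𝓝 x, ∃ A B : Set X, A ⊆ V ∧ B ⊆ V ∧ IsPreconnected A ∧ IsPreconnected B ∧
    Disjoint A M ∧ Disjoint B M ∧ A ∪ B ∪ M ∈ 𝓝 x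

theorem SignType.exists_unit_of_ne_zero {a : SignType} (h : a ≠ 0) :
    ∃ ε : SignTypeˣ, a = ε := ⟨Units.mk0 a h, rfl⟩

theorem SignType.unit_eq_or_eq_neg (a b : SignTypeˣ) : a = b ∨ a = -b := by
  revert a b; decide

theorem SignType.unit_mul_self (a : SignTypeˣ) : a * a = 1 := by
  revert a; decide

theorem IsSideOn.exists_mem_eq (h : IsSideOn M U σ) (hx : x ∈ U) (hxM : x ∈ M)
    (hV : V ∈ 𝓝 x) (ε : SignTypeˣ) : ∃ y ∈ V, σ y = ε := by
  obtain ⟨y, hy, hyσ⟩ := mem_closure_iff_nhds.1 (h.mem_closure x hx hxM ε) V hV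
  exact ⟨y, hy, hyσ⟩

theorem IsSideOn.eventually_eq_of_notMem (h : IsSideOn M U σ) (hM : IsClosed M) (hx : x ∈ U)
    (hxM : x ∉ M) : ∀ᶠ y in 𝓝 x, σ y = σ x := by
  have : ContinuousAt σ x :=
    h.continuousOn.continuousAt ((h.isOpen.sdiff hM).mem_nhds ⟨hx, hxM⟩)
  rwa [ContinuousAt, nhds_discrete SignType, tendsto_pure] at this

/-- Each piece is connected and avoids `M`, so `σ` is constant on it. Both signs occur near `x` and
only `A` and `B` can carry them, so the two constants are opposite. -/
theorem IsSideOn.exists_sign_on_sides (h : IsSideOn M U σ) (hx : x ∈ U) (hxM : x ∈ M)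
    {A B : Set X} (hA : A ⊆ U) (hB : B ⊆ U) (cA : IsPreconnected A) (cB : IsPreconnected B)
    (dA : Disjoint A M) (dB : Disjoint B M) (hAB : A ∪ B ∪ M ∈ 𝓝 x) :
    ∃ ε : SignTypeˣ, (∀ y ∈ A, σ y = ε) ∧ ∀ y ∈ B, σ y = (-ε : SignTypeˣ) := by
  have hW : (A ∪ B ∪ M) ∩ U ∈ 𝓝 x := inter_mem hAB (h.isOpen.mem_nhds hx)
  have key : ∀ ε : SignTypeˣ, ∃ y ∈ A ∪ B, σ y = ε := by
    intro ε
    obtain ⟨y, ⟨hy, hyU⟩, hε⟩ := h.exists_mem_eq hx hxM hW ε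
    refine ⟨y, hy.resolve_right fun hyM => ?_, hε⟩
    exact ε.ne_zero (hε.symm.trans ((h.zero_iff y hyU).2 hyM))
  have kA : ∀ y ∈ A, ∀ z ∈ A, σ y = σ z := fun y hy z hz =>
    cA.constant (h.continuousOn.mono (subset_sdiff.2 ⟨hA, dA⟩)) hy hz
  have kB : ∀ y ∈ B, ∀ z ∈ B, σ y = σ z := fun y hy z hz =>
    cB.constant (h.continuousOn.mono (subset_sdiff.2 ⟨hB, dB⟩)) hy hz
  have ne : ((1 : SignTypeˣ) : SignType) ≠ ((-1 : SignTypeˣ) : SignType) := by decide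
  obtain ⟨y, hy, hy1⟩ := key 1
  obtain ⟨z, hz, hz1⟩ := key (-1)
  rcases hy with hy | hy <;> rcases hz with hz | hz
  · exact absurd (hy1.symm.trans ((kA y hy z hz).trans hz1)) ne
  · exact ⟨1, fun w hw => (kA w hw y hy).trans hy1, fun w hw => (kB w hw z hz).trans hz1⟩
  · exact ⟨-1, fun w hw => (kA w hw z hz).trans hz1, fun w hw => by
      rw [neg_neg]; exact (kB w hw y hy).trans hy1⟩
  · exact absurd (hy1.symm.trans ((kB y hy z hz).trans hz1)) ne

/-- Two side functions agree, up to a sign, near each common point. -/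
theorem IsSideOn.exists_unit (hM : IsClosed M) (hT : ∀ x ∈ M, TwoSidedAt M x)
    (h : IsSideOn M U σ) (h' : IsSideOn M V τ) (hx : x ∈ U) (hx' : x ∈ V) :
    ∃ g : SignTypeˣ, ∀ᶠ y in 𝓝 x, τ y = g * σ y := by
  by_cases hxM : x ∈ M
  · have hUV : U ∩ V ∈ 𝓝 x := inter_mem (h.isOpen.mem_nhds hx) (h'.isOpen.mem_nhds hx')
    obtain ⟨A, B, hA, hB, cA, cB, dA, dB, hAB⟩ := hT x hxM _ hUV
    obtain ⟨ε, hεA, hεB⟩ := h.exists_sign_on_sides hx hxM (hA.trans inter_subset_left)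
      (hB.trans inter_subset_left) cA cB dA dB hAB
    obtain ⟨δ, hδA, hδB⟩ := h'.exists_sign_on_sides hx' hxM (hA.trans inter_subset_right)
      (hB.trans inter_subset_right) cA cB dA dB hAB
    -- Signs are their own inverses, so `δ * ε` carries `ε` to `δ` and `-ε` to `-δ`.
    refine ⟨δ * ε, ?_⟩
    filter_upwards [hAB, hUV] with y hy hyUV
    rcases hy with (hy | hy) | hy
    · rw [hεA y hy, hδA y hy, ← Units.val_mul, mul_assoc, SignType.unit_mul_self, mul_one]
    · rw [hεB y hy, hδB y hy, ← Units.val_mul, mul_assoc, mul_neg, SignType.unit_mul_self,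
        mul_neg, mul_one]
    · rw [(h.zero_iff y hyUV.1).2 hy, (h'.zero_iff y hyUV.2).2 hy, mul_zero]
  · obtain ⟨ε, hε⟩ := SignType.exists_unit_of_ne_zero (mt (h.zero_iff x hx).1 hxM)
    obtain ⟨δ, hδ⟩ := SignType.exists_unit_of_ne_zero (mt (h'.zero_iff x hx').1 hxM)
    refine ⟨δ * ε, ?_⟩
    filter_upwards [h.eventually_eq_of_notMem hM hx hxM, h'.eventually_eq_of_notMem hM hx' hxM]
      with y hy hy'
    rw [hy, hy', hε, hδ, ← Units.val_mul, mul_assoc, SignType.unit_mul_self, mul_one]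

theorem IsSideOn.exists_ne_zero (h : IsSideOn M U σ) (hx : x ∈ U) {W : Set X} (hW : W ∈ 𝓝 x) :
    ∃ y ∈ W, σ y ≠ 0 := by
  by_cases hxM : x ∈ M
  · obtain ⟨y, hy, hε⟩ := h.exists_mem_eq hx hxM hW 1
    exact ⟨y, hy, hε ▸ (1 : SignTypeˣ).ne_zero⟩
  · exact ⟨x, mem_of_mem_nhds hW, mt (h.zero_iff x hx).1 hxM⟩

theorem IsSideOn.unit_unique (h : IsSideOn M U σ) (hx : x ∈ U) {g g' : SignTypeˣ}
    (hg : ∀ᶠ y in 𝓝 x, τ y = g * σ y) (hg' : ∀ᶠ y in 𝓝 x, τ y = g' * σ y) : g = g' := by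
  obtain ⟨y, ⟨hy, hy'⟩, h0⟩ := h.exists_ne_zero hx (inter_mem hg hg')
  exact Units.ext (mul_right_cancel₀ h0 (hy.symm.trans hy'))

theorem isSideOn_univ_of_locally (hM : IsClosed M)
    (h : ∀ x, ∃ (U : Set X) (τ : X → SignType) (g : SignTypeˣ), IsSideOn M U τ ∧ x ∈ U ∧
      ∀ᶠ y in 𝓝 x, σ y = g * τ y) : IsSideOn M univ σ where
  isOpen := isOpen_univ
  zero_iff y _ := by
    obtain ⟨U, τ, g, hτ, hy, hg⟩ := h y
    rw [hg.self_of_nhds, ← hτ.zero_iff y hy, mul_eq_zero, or_iff_right g.ne_zero]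
  continuousOn := by
    rintro y ⟨_, hyM⟩
    obtain ⟨U, τ, g, hτ, hy, hg⟩ := h y
    refine ContinuousAt.continuousWithinAt ?_
    refine (continuousAt_const (y := σ y)).congr ?_
    filter_upwards [hg, hτ.eventually_eq_of_notMem hM hy hyM] with z hz hz'
    rw [hz, hz', hg.self_of_nhds]
  mem_closure y _ hyM ε := by
    obtain ⟨U, τ, g, hτ, hy, hg⟩ := h y
    refine mem_closure_iff_nhds.2 fun W hW => ?_
    obtain ⟨z, ⟨hzW, hz⟩, hzε⟩ := hτ.exists_mem_eq hy hyM (inter_mem hW hg) (g * ε)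
    refine ⟨z, hzW, ?_⟩
    change σ z = ε
    rw [show σ z = g * τ z from hz, hzε, ← Units.val_mul, ← mul_assoc, SignType.unit_mul_self,
      one_mul]

theorem isSideOn_compl (hM : IsClosed M) : IsSideOn M Mᶜ (fun _ => 1) where
  isOpen := hM.isOpen_compl
  zero_iff y hy := by simpa using hy
  continuousOn := continuousOn_const
  mem_closure y hy hy' := absurd hy' hy

/-! ### The double cover of germs of side functions -/

variable (M) in
/-- A side function together with its domain. -/
abbrev LocalSide := {p : Set X × (X → SignType) // IsSideOn M p.1 p.2}

open Classical in
/-- The sign by which two side functions differ near `x`. -/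
noncomputable def LocalSide.sign (i j : LocalSide M) (x : X) : SignTypeˣ :=
  -- The default `1` plays no role where both domains contain `x`: there the sign exists and is
  -- unique.
  if h : ∃ g : SignTypeˣ, ∀ᶠ y in 𝓝 x, j.1.2 y = g * i.1.2 y then h.choose else 1

section

variable (hM : IsClosed M) (hT : ∀ x ∈ M, TwoSidedAt M x)
include hM hT

theorem LocalSide.eventually_sign {i j : LocalSide M} (hi : x ∈ i.1.1) (hj : x ∈ j.1.1) :
    ∀ᶠ y in 𝓝 x, j.1.2 y = i.sign j x * i.1.2 y := by
  have h := i.2.exists_unit hM hT j.2 hi hj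
  rw [LocalSide.sign, dif_pos h]
  exact h.choose_spec

theorem LocalSide.sign_eq {i j : LocalSide M} {g : SignTypeˣ} (hi : x ∈ i.1.1) (hj : x ∈ j.1.1)
    (hg : ∀ᶠ y in 𝓝 x, j.1.2 y = g * i.1.2 y) : i.sign j x = g :=
  i.2.unit_unique hi (LocalSide.eventually_sign hM hT hi hj) hg

/-- The two-sheeted covering whose points over `x` are the two germs of side functions at `x`. -/
noncomputable def sideCore (hS : ∀ x ∈ M, ∃ i : LocalSide M, x ∈ i.1.1) :
    FiberBundleCore (LocalSide M) X SignTypeˣ :=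
  -- Off `M` the constant `1` is a side function, so only points of `M` need a hypothesis.
  have hS' : ∀ x, ∃ i : LocalSide M, x ∈ i.1.1 := fun x =>
    (em (x ∈ M)).elim (hS x) fun h => ⟨⟨(Mᶜ, fun _ => 1), isSideOn_compl hM⟩, h⟩
  { baseSet i := i.1.1
    isOpen_baseSet i := i.2.isOpen
    indexAt x := (hS' x).choose
    mem_baseSet_at x := (hS' x).choose_spec
    coordChange i j x v := i.sign j x * v
    coordChange_self i x hx v := by
      rw [LocalSide.sign_eq hM hT hx hx (g := 1) (by simp), one_mul]
    continuousOn_coordChange i j := by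
      rintro ⟨x, v⟩ ⟨⟨hi, hj⟩, _⟩
      have h1 : ∀ᶠ y in 𝓝 x, i.sign j y = i.sign j x := by
        filter_upwards [(LocalSide.eventually_sign hM hT hi hj).eventually_nhds,
          i.2.isOpen.mem_nhds hi, j.2.isOpen.mem_nhds hj] with y hy hyi hyj
        exact LocalSide.sign_eq hM hT hyi hyj hy
      have h2 : ContinuousAt (fun y => i.sign j y) x := continuousAt_const.congr
        (h1.mono fun y hy => hy.symm)
      exact ((h2.comp (f := Prod.fst) (x := (x, v)) continuousAt_fst).mul
        continuousAt_snd).continuousWithinAt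
    coordChange_comp i j k x hx v := by
      rw [← mul_assoc]
      congr 1
      refine (LocalSide.sign_eq hM hT hx.1.1 hx.2 ?_).symm
      filter_upwards [LocalSide.eventually_sign hM hT hx.1.1 hx.1.2,
        LocalSide.eventually_sign hM hT hx.1.2 hx.2] with y hy hy'
      rw [hy', hy, Units.val_mul, mul_assoc] }

/-- A continuous section of the covering of germs of side functions is a global side function. -/
theorem exists_isSideOn_univ_of_section (hS : ∀ x ∈ M, ∃ i : LocalSide M, x ∈ i.1.1)
    {s : X → (sideCore hM hT hS).TotalSpace} (hs : Continuous s)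
    (hsp : ∀ x, (s x).proj = x) : ∃ σ : X → SignType, IsSideOn M univ σ := by
  let Z := sideCore hM hT hS
  -- `t` evaluates a germ at its base point; `ht` shows that any local trivialization computes the
  -- same value.
  let t : Z.TotalSpace → SignType := fun z => Units.val (show SignTypeˣ from z.2) *
    (Z.indexAt z.1).1.2 z.1
  have ht : ∀ (i : LocalSide M) (z : Z.TotalSpace), z.1 ∈ i.1.1 →
      t z = ((Z.localTriv i z).2 : SignType) * i.1.2 z.1 := by
    intro i z hz
    have h := (LocalSide.eventually_sign hM hT (Z.mem_baseSet_at z.1) hz).self_of_nhds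
    change Units.val (show SignTypeˣ from z.2) * _ =
      Units.val ((Z.indexAt z.1).sign i z.1 * (show SignTypeˣ from z.2)) * i.1.2 z.1
    rw [h, ← mul_assoc, ← Units.val_mul, mul_right_comm, SignType.unit_mul_self, one_mul]
  refine ⟨fun x => t (s x), isSideOn_univ_of_locally hM fun x => ?_⟩
  refine ⟨_, _, (Z.localTriv (Z.indexAt x) (s x)).2, (Z.indexAt x).2, Z.mem_baseSet_at x, ?_⟩
  have hmem : s x ∈ (Z.localTriv (Z.indexAt x)).source := by
    change (s x).proj ∈ Z.baseSet (Z.indexAt x)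
    rw [hsp]; exact Z.mem_baseSet_at x
  have hc : ContinuousAt (fun y => (Z.localTriv (Z.indexAt x) (s y)).2) x :=
    (((Z.localTriv (Z.indexAt x)).toOpenPartialHomeomorph.continuousAt hmem).comp
      hs.continuousAt).snd
  have hc' : ∀ᶠ y in 𝓝 x, (Z.localTriv (Z.indexAt x) (s y)).2 =
      (Z.localTriv (Z.indexAt x) (s x)).2 := by
    rwa [ContinuousAt, nhds_discrete SignTypeˣ, tendsto_pure] at hc
  filter_upwards [hc', (Z.isOpen_baseSet _).mem_nhds (Z.mem_baseSet_at x)] with y hy hyU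
  rw [ht (Z.indexAt x) (s y) (by rw [hsp]; exact hyU), hy, hsp]

/-- If the space is covered by simply connected open sets with preconnected pairwise intersections
and a common point, then there is a global side function. -/
theorem exists_isSideOn_univ (hS : ∀ x ∈ M, ∃ i : LocalSide M, x ∈ i.1.1)
    {Y κ : Type*} [TopologicalSpace Y] [SimplyConnectedSpace Y] [LocallyPathConnectedSpace Y]
    (e : κ → OpenPartialHomeomorph X Y) (he : ∀ k, (e k).target = univ)
    (hcov : ∀ x, ∃ k, x ∈ (e k).source)
    (hpre : ∀ k l, IsPreconnected ((e k).source ∩ (e l).source)) (b : X)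
    (hb : ∀ k, b ∈ (e k).source) : ∃ σ : X → SignType, IsSideOn M univ σ := by
  set Z := sideCore hM hT hS with hZ
  have cov : IsCoveringMap Z.proj := FiberBundle.isCoveringMap (F := SignTypeˣ) (E := Z.Fiber)
  have hcont : ∀ k, Continuous (e k).symm := fun k => by
    rw [← continuousOn_univ, ← he k]; exact (e k).continuousOn_symm
  -- All lifts pass through the same point over `b`. Hence two of them agree on the overlap of their
  -- charts, which is preconnected and contains `b`.
  have lift : ∀ k, ∃ F : C(Y, Z.TotalSpace), F (e k b) = ⟨b, (1 : SignTypeˣ)⟩ ∧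
      Z.proj ∘ F = (e k).symm := fun k =>
    (cov.existsUnique_continuousMap_lifts ⟨(e k).symm, hcont k⟩ (e k b)
      (⟨b, (1 : SignTypeˣ)⟩ : Z.TotalSpace) ((e k).left_inv (hb k)).symm).exists
  choose F hF hFp using lift
  choose k hk using hcov
  have hproj : ∀ l x, x ∈ (e l).source → (F l (e l x)).proj = x := fun l x hx =>
    (congrFun (hFp l) (e l x)).trans ((e l).left_inv hx)
  have hFc : ∀ l, ContinuousOn (fun x => F l (e l x)) (e l).source := fun l =>
    (F l).continuous.comp_continuousOn (e l).continuousOn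
  have hagree : ∀ l m, EqOn (fun x => F l (e l x)) (fun x => F m (e m x))
      ((e l).source ∩ (e m).source) := fun l m =>
    cov.eqOn_of_comp_eqOn (hpre l m) ((hFc l).mono inter_subset_left)
      ((hFc m).mono inter_subset_right)
      (fun x hx => (hproj l x hx.1).trans (hproj m x hx.2).symm) ⟨hb l, hb m⟩
      ((hF l).trans (hF m).symm)
  refine exists_isSideOn_univ_of_section hM hT hS (s := fun x => F (k x) (e (k x) x)) ?_
    fun x => hproj _ x (hk x)
  refine continuous_iff_continuousAt.2 fun x => ?_
  refine ((hFc (k x)).continuousAt ((e (k x)).open_source.mem_nhds (hk x))).congr ?_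
  filter_upwards [(e (k x)).open_source.mem_nhds (hk x)] with y hy
  exact hagree _ _ ⟨hy, hk y⟩

end

/-- If `M` is connected, then each of the two sides of `M` is connected. -/
theorem IsSideOn.isPreconnected_side [PreconnectedSpace X] (hM : IsClosed M)
    (hT : ∀ x ∈ M, TwoSidedAt M x) (hconn : IsConnected M) (h : IsSideOn M univ σ)
    (ε : SignTypeˣ) : IsPreconnected {x | σ x = ε} := by
  have hopen : IsOpen {x | σ x = ε} := isOpen_iff_mem_nhds.2 fun x hx => by
    have hxM : x ∉ M := fun hxM => ε.ne_zero (hx.symm.trans ((h.zero_iff x trivial).2 hxM))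
    filter_upwards [h.eventually_eq_of_notMem hM trivial hxM] with y hy
    exact hy.trans hx
  rw [isPreconnected_iff_subset_of_disjoint]
  intro u v hu hv huv hdisj
  -- If the side lies in `u` near every point of `M`, its part in `v` does not accumulate on `M`.
  -- That part is then clopen in `X`, and it misses the nonempty set `M`, so it is empty.
  have hclosed : ∀ u v : Set X, IsOpen u → IsOpen v → {x | σ x = ε} ⊆ u ∪ v →
      {x | σ x = ε} ∩ (u ∩ v) = ∅ → (∀ x ∈ M, ∀ᶠ y in 𝓝 x, σ y = ε → y ∈ u) →
      {x | σ x = ε} ⊆ u := by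
    intro u v hu hv huv hdisj hMu
    have hT : IsClopen ({x | σ x = ε} ∩ v) := by
      refine ⟨⟨isOpen_iff_mem_nhds.2 fun x hx => ?_⟩, hopen.inter hv⟩
      by_cases hxM : x ∈ M
      · filter_upwards [hMu x hxM] with y hy hy'
        exact eq_empty_iff_forall_notMem.1 hdisj y ⟨hy'.1, hy hy'.1, hy'.2⟩
      · by_cases hxε : σ x = ε
        · have hxu : x ∈ u := (huv hxε).resolve_right fun hxv => hx ⟨hxε, hxv⟩
          filter_upwards [hu.mem_nhds hxu] with y hy hy'
          exact eq_empty_iff_forall_notMem.1 hdisj y ⟨hy'.1, hy, hy'.2⟩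
        · filter_upwards [h.eventually_eq_of_notMem hM trivial hxM] with y hy hy'
          exact hxε (hy.symm.trans hy'.1)
    rcases isClopen_iff.1 hT with h0 | h1
    · exact fun x hx => (huv hx).resolve_right fun hxv =>
        eq_empty_iff_forall_notMem.1 h0 x ⟨hx, hxv⟩
    · obtain ⟨x, hx⟩ := hconn.nonempty
      have : x ∈ {x | σ x = ε} ∩ v := h1 ▸ mem_univ x
      exact absurd (this.1.symm.trans ((h.zero_iff x trivial).2 hx)) ε.ne_zero
  -- Near a point of `M` the side is a single one of the two local pieces; being preconnected, that
  -- piece lies in `u` or in `v`.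
  have hloc : ∀ x ∈ M, (∀ᶠ y in 𝓝 x, σ y = ε → y ∈ u) ∨ ∀ᶠ y in 𝓝 x, σ y = ε → y ∈ v := by
    intro x hx
    obtain ⟨A, B, -, -, cA, cB, dA, dB, hAB⟩ := hT x hx univ univ_mem
    obtain ⟨δ, hδA, hδB⟩ := h.exists_sign_on_sides trivial hx (subset_univ A) (subset_univ B)
      cA cB dA dB hAB
    have hne : ∀ δ : SignTypeˣ, (δ : SignType) ≠ (-δ : SignTypeˣ) := by decide
    have hsplit : ∀ C D : Set X, IsPreconnected C → C ∪ D ∪ M ∈ 𝓝 x → (∀ y ∈ C, σ y = ε) →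
        (∀ y ∈ D, σ y ≠ ε) →
        (∀ᶠ y in 𝓝 x, σ y = ε → y ∈ u) ∨ ∀ᶠ y in 𝓝 x, σ y = ε → y ∈ v := by
      intro C D cC hCD hC hD
      refine (isPreconnected_iff_subset_of_disjoint.1 cC u v hu hv
        (fun y hy => huv (hC y hy)) (subset_eq_empty (inter_subset_inter_left _ hC) hdisj)).imp
        (fun hCu => ?_) (fun hCu => ?_) <;>
      · filter_upwards [hCD] with y hy hyε
        rcases hy with (hy | hy) | hy
        · exact hCu hy
        · exact absurd hyε (hD y hy)
        · exact absurd (hyε.symm.trans ((h.zero_iff y trivial).2 hy)) ε.ne_zero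
    rcases SignType.unit_eq_or_eq_neg δ ε with rfl | rfl
    · exact hsplit A B cA hAB hδA fun y hy hy' => hne _ (hy'.symm.trans (hδB y hy))
    · rw [neg_neg] at hδB
      exact hsplit B A cB (union_comm A B ▸ hAB) hδB fun y hy hy' =>
        hne _ (hy'.symm.trans (hδA y hy))
  have hopen' : ∀ w : Set X, IsOpen {x | ∀ᶠ y in 𝓝 x, σ y = ε → y ∈ w} := fun w =>
    isOpen_iff_mem_nhds.2 fun x hx => Filter.Eventually.eventually_nhds hx
  have hdisj' : M ∩ ({x | ∀ᶠ y in 𝓝 x, σ y = ε → y ∈ u} ∩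
      {x | ∀ᶠ y in 𝓝 x, σ y = ε → y ∈ v}) = ∅ := by
    refine eq_empty_iff_forall_notMem.2 ?_
    rintro x ⟨hx, hxu, hxv⟩
    obtain ⟨y, ⟨hyu, hyv⟩, hy⟩ := h.exists_mem_eq trivial hx (inter_mem hxu hxv) ε
    exact eq_empty_iff_forall_notMem.1 hdisj y ⟨hy, hyu hy, hyv hy⟩
  rcases isPreconnected_iff_subset_of_disjoint.1 hconn.isPreconnected _ _ (hopen' u) (hopen' v)
    (fun x hx => hloc x hx) hdisj' with hMu | hMv
  · exact Or.inl (hclosed u v hu hv huv hdisj hMu)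
  · exact Or.inr (hclosed v u hv hu (union_comm u v ▸ huv) (inter_comm u v ▸ hdisj) hMv)

/-- The complement of a closed connected two-sided set has exactly two components. -/
theorem IsSideOn.card_connectedComponents_compl [PreconnectedSpace X] (hM : IsClosed M)
    (hT : ∀ x ∈ M, TwoSidedAt M x) (hconn : IsConnected M) (h : IsSideOn M univ σ) :
    Nat.card (ConnectedComponents (Mᶜ : Set X)) = 2 := by
  have hc : Continuous fun x : (Mᶜ : Set X) => σ x := by
    refine (continuousOn_iff_continuous_domRestrict.1 (h.continuousOn.mono ?_))
    exact fun x hx => ⟨trivial, hx⟩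
  have hne : ∀ x : (Mᶜ : Set X), σ x ≠ 0 := fun x hx => x.2 ((h.zero_iff x trivial).1 hx)
  -- The sign of a component: injective because each side is preconnected, surjective because both
  -- signs are attained near `M`.
  let f : ConnectedComponents (Mᶜ : Set X) → SignTypeˣ := fun c =>
    Units.mk0 (hc.connectedComponentsLift c) (by
      obtain ⟨x, rfl⟩ := ConnectedComponents.surjective_coe c
      rw [hc.connectedComponentsLift_apply_coe]
      exact hne x)
  have hf : ∀ x : (Mᶜ : Set X), (f x : SignType) = σ x := fun x =>
    hc.connectedComponentsLift_apply_coe x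
  have hbij : Function.Bijective f := by
    constructor
    · intro c d hcd
      obtain ⟨x, rfl⟩ := ConnectedComponents.surjective_coe c
      obtain ⟨y, rfl⟩ := ConnectedComponents.surjective_coe d
      have hpre := h.isPreconnected_side hM hT hconn (f x)
      have hsub : {z | σ z = f x} ⊆ range ((↑) : (Mᶜ : Set X) → X) := by
        rw [Subtype.range_coe]
        exact fun z hz hzM => (f x).ne_zero (hz.symm.trans ((h.zero_iff z trivial).2 hzM))
      rw [← image_preimage_eq_of_subset hsub, Topology.IsInducing.subtypeVal.isPreconnected_image]
        at hpre
      refine ConnectedComponents.coe_eq_coe'.2 ?_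
      refine hpre.subset_connectedComponent (x := y) ?_ ?_
      · exact (hf y).symm.trans (congrArg Units.val hcd.symm)
      · exact (hf x).symm
    · intro ε
      obtain ⟨x, hx⟩ := hconn.nonempty
      obtain ⟨y, -, hy⟩ := h.exists_mem_eq trivial hx univ_mem ε
      have hyM : y ∉ M := fun hyM => ε.ne_zero (hy.symm.trans ((h.zero_iff y trivial).2 hyM))
      exact ⟨(⟨y, hyM⟩ : (Mᶜ : Set X)), Units.ext ((hf _).trans hy)⟩
  rw [Nat.card_eq_of_bijective f hbij, Nat.card_eq_fintype_card]
  decide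

end Sides

/-! ### Topology of complex projective space -/

namespace CP

variable {n : ℕ}

/-- The set is a product of copies of `ℂ` and of `ℂ` minus a point, the latter connected since `ℂ`
has real dimension 2. -/
theorem isPreconnected_setOf_forall_mem_ne_zero {ι : Type*} (S : Set ι) :
    IsPreconnected {v : ι → ℂ | ∀ i ∈ S, v i ≠ 0} := by
  classical
  have : {v : ι → ℂ | ∀ i ∈ S, v i ≠ 0} =
      univ.pi fun i => if i ∈ S then ({0}ᶜ : Set ℂ) else univ := by
    ext v
    simp only [mem_ofPred_eq, mem_univ_pi]
    refine forall_congr' fun i => ?_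
    by_cases hi : i ∈ S <;> simp [hi]
  rw [this]
  refine isPreconnected_univ_pi fun i => ?_
  by_cases hi : i ∈ S
  · simp only [hi, if_true]
    exact (isConnected_compl_singleton_of_one_lt_rank
      (by rw [Complex.rank_real_complex]; norm_num) 0).isPreconnected
  · simp only [hi, if_false]
    exact isPreconnected_univ

theorem isPreconnected_inter_affineDomain (i j : Fin (n + 1)) :
    IsPreconnected (affineDomain (n := n) i ∩ affineDomain j) := by
  have hpre := isPreconnected_setOf_forall_mem_ne_zero ({i, j} : Set (Fin (n + 1)))
  have hsub : {v : Fin (n + 1) → ℂ | ∀ k ∈ ({i, j} : Set (Fin (n + 1))), v k ≠ 0} ⊆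
      range (Subtype.val : {v : Fin (n + 1) → ℂ // v ≠ 0} → _) := by
    intro v hv
    exact ⟨⟨v, fun h => hv i (by simp) (by simp [h])⟩, rfl⟩
  rw [← image_preimage_eq_of_subset hsub] at hpre
  replace hpre := (IsInducing.isPreconnected_image (f := Subtype.val) ⟨rfl⟩).1 hpre
  convert! hpre.image proj isQuotientMap_proj.continuous.continuousOn using 1
  ext p
  obtain ⟨v, rfl⟩ := proj_surjective p
  constructor
  · rintro ⟨hi, hj⟩
    rw [proj_mem_affineDomain] at hi hj
    refine ⟨v, ?_, rfl⟩
    rintro k (rfl | rfl) <;> assumption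
  · rintro ⟨w, hw, hwv⟩
    rw [← hwv]
    exact ⟨(proj_mem_affineDomain i w).2 (hw i (by simp)),
      (proj_mem_affineDomain j w).2 (hw j (by simp))⟩

/-- The point `[1 : ⋯ : 1]`. -/
noncomputable def ones : CP n := proj ⟨fun _ => 1, fun h => one_ne_zero (congrFun h 0)⟩

theorem ones_mem_affineDomain (i : Fin (n + 1)) : (ones : CP n) ∈ affineDomain i :=
  (proj_mem_affineDomain i _).2 one_ne_zero

instance instPreconnectedSpace : PreconnectedSpace (CP n) :=
  ⟨by
    have h : IsPreconnected (⋃ i, affineDomain (n := n) i) :=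
      isPreconnected_iUnion ⟨ones, mem_iInter.2 ones_mem_affineDomain⟩ fun i => by
        simpa using isPreconnected_inter_affineDomain i i
    rwa [iUnion_eq_univ_iff.2 exists_mem_affineDomain] at h⟩

theorem isOpenMap_proj : IsOpenMap (proj (n := n)) := by
  intro s hs
  rw [← isQuotientMap_proj.isOpen_preimage, isOpen_iff_mem_nhds]
  rintro v ⟨w, hw, hwv⟩
  obtain ⟨a, ha⟩ := (proj_eq_iff w v).1 hwv
  have ha0 : a ≠ 0 := by
    rintro rfl
    exact w.2 (by rw [← ha, zero_smul])
  let m : {v : Fin (n + 1) → ℂ // v ≠ 0} → {v : Fin (n + 1) → ℂ // v ≠ 0} :=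
    fun u => ⟨a • u.1, smul_ne_zero ha0 u.2⟩
  have hm : Continuous m := (continuous_subtype_val.const_smul a).subtype_mk _
  have hmv : m v = w := Subtype.ext ha
  filter_upwards [hm.continuousAt.preimage_mem_nhds (hs.mem_nhds (hmv ▸ hw))] with u hu
  exact ⟨m u, hu, (proj_eq_iff _ _).2 ⟨a, rfl⟩⟩

/-- Vanishing of the 2×2 minors is a closed condition on pairs, which is what the Hausdorff property
needs. -/
theorem proj_eq_iff_mul (v w : {v : Fin (n + 1) → ℂ // v ≠ 0}) :
    proj v = proj w ↔ ∀ i j, v.1 i * w.1 j = v.1 j * w.1 i := by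
  rw [proj_eq_iff]
  constructor
  · rintro ⟨a, ha⟩ i j
    simp only [← ha, Pi.smul_apply, smul_eq_mul]
    ring
  · intro h
    obtain ⟨i, hi⟩ := Function.ne_iff.1 w.2
    refine ⟨v.1 i / w.1 i, funext fun j => ?_⟩
    simp only [Pi.smul_apply, smul_eq_mul, Pi.zero_apply] at hi ⊢
    rw [div_mul_eq_mul_div, h i j, mul_div_cancel_right₀ _ hi]

instance instT2Space : T2Space (CP n) := by
  rw [t2Space_iff_of_isOpenQuotientMap
    ⟨proj_surjective, isQuotientMap_proj.continuous, isOpenMap_proj⟩]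
  simp only [proj_eq_iff_mul, ofPred_forall]
  have hc : ∀ i, Continuous fun v : {v : Fin (n + 1) → ℂ // v ≠ 0} => v.1 i := fun i =>
    (continuous_apply i).comp continuous_subtype_val
  exact isClosed_iInter fun i => isClosed_iInter fun j => isClosed_eq
    (((hc i).comp continuous_fst).mul ((hc j).comp continuous_snd))
    (((hc j).comp continuous_fst).mul ((hc i).comp continuous_snd))

/-- A closed two-sided subset of `CP n` that has local side functions has a global one. -/
theorem exists_isSideOn_univ {M : Set (CP n)} (hM : IsClosed M) (hT : ∀ x ∈ M, TwoSidedAt M x)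
    (hS : ∀ x ∈ M, ∃ i : LocalSide M, x ∈ i.1.1) : ∃ σ : CP n → SignType, IsSideOn M univ σ :=
  _root_.exists_isSideOn_univ hM hT hS affineChart (fun _ => rfl) exists_mem_affineDomain
    isPreconnected_inter_affineDomain ones ones_mem_affineDomain

end CP

/-! ### Slice coordinates -/

section Slices

variable {X K : Type*} [TopologicalSpace X] [NormedAddCommGroup K] {M : Set X}

/-- In the local coordinates `Θ`, the set `M` is the zero locus of the first coordinate. -/
def IsSlice (M : Set X) (Θ : OpenPartialHomeomorph X (ℝ × K)) : Prop :=
  ∀ x ∈ Θ.source, x ∈ M ↔ (Θ x).1 = 0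

theorem OpenPartialHomeomorph.exists_ball_subset {Z : Type*} [PseudoMetricSpace Z]
    (Θ : OpenPartialHomeomorph X Z) {x : X} (hx : x ∈ Θ.source) {V : Set X} (hV : V ∈ 𝓝 x) :
    ∃ r > 0, Metric.ball (Θ x) r ⊆ Θ.target ∩ Θ.symm ⁻¹' V := by
  refine Metric.mem_nhds_iff.1 (inter_mem (Θ.open_target.mem_nhds (Θ.map_source hx)) ?_)
  refine (Θ.continuousAt_symm (Θ.map_source hx)).preimage_mem_nhds ?_
  rwa [Θ.left_inv hx]

variable {Θ : OpenPartialHomeomorph X (ℝ × K)}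

/-- The two pieces are the open half balls in the coordinates, which are convex. -/
theorem IsSlice.twoSidedAt [NormedSpace ℝ K] (hΘ : IsSlice M Θ) {x : X} (hx : x ∈ Θ.source) : TwoSidedAt M x := by
  intro V hV
  obtain ⟨r, hr, hball⟩ := Θ.exists_ball_subset hx hV
  have hpre : ∀ H : Set (ℝ × K), Convex ℝ H →
      IsPreconnected (Θ.symm '' (Metric.ball (Θ x) r ∩ H)) := fun H hH =>
    ((convex_ball _ _).inter hH).isPreconnected.image _
      (Θ.continuousOn_symm.mono fun y hy => (hball hy.1).1)
  have hdisj : ∀ H : Set (ℝ × K), (∀ z ∈ H, z.1 ≠ 0) →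
      Disjoint (Θ.symm '' (Metric.ball (Θ x) r ∩ H)) M := by
    intro H hH
    rw [disjoint_left]
    rintro _ ⟨z, ⟨hz, hzH⟩, rfl⟩ hM
    have := (hΘ _ (Θ.map_target (hball hz).1)).1 hM
    rw [Θ.right_inv (hball hz).1] at this
    exact hH z hzH this
  have hsub : ∀ H : Set (ℝ × K), Θ.symm '' (Metric.ball (Θ x) r ∩ H) ⊆ V := by
    rintro H _ ⟨z, ⟨hz, -⟩, rfl⟩
    exact (hball hz).2
  refine ⟨_, _, hsub {z | 0 < z.1}, hsub {z | z.1 < 0},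
    hpre _ (convex_halfSpace_gt (f := Prod.fst) ⟨fun _ _ => rfl, fun _ _ => rfl⟩ 0),
    hpre _ (convex_halfSpace_lt (f := Prod.fst) ⟨fun _ _ => rfl, fun _ _ => rfl⟩ 0),
    hdisj _ fun z hz => ne_of_gt hz, hdisj _ fun z hz => ne_of_lt hz, ?_⟩
  filter_upwards [(Θ.continuousAt hx).preimage_mem_nhds (Metric.ball_mem_nhds _ hr),
    Θ.open_source.mem_nhds hx] with y hy hys
  rcases lt_trichotomy (Θ y).1 0 with h | h | h
  · exact Or.inl (Or.inr ⟨Θ y, ⟨hy, h⟩, Θ.left_inv hys⟩)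
  · exact Or.inr ((hΘ y hys).2 h)
  · exact Or.inl (Or.inl ⟨Θ y, ⟨hy, h⟩, Θ.left_inv hys⟩)

theorem IsSlice.isSideOn (hΘ : IsSlice M Θ) :
    IsSideOn M Θ.source fun x => SignType.sign (Θ x).1 where
  isOpen := Θ.open_source
  zero_iff y hy := by rw [sign_eq_zero_iff, hΘ y hy]
  continuousOn := by
    rintro y ⟨hy, hyM⟩
    refine ContinuousAt.continuousWithinAt ?_
    exact (continuousAt_sign_of_ne_zero (mt (hΘ y hy).2 hyM)).comp
      (f := fun x => (Θ x).1) (Θ.continuousAt hy).fst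
  mem_closure y hy hyM ε := by
    refine mem_closure_iff_nhds.2 fun W hW => ?_
    obtain ⟨r, hr, hball⟩ := Θ.exists_ball_subset hy hW
    have h0 : (Θ y).1 = 0 := (hΘ y hy).1 hyM
    -- Points of either sign near `y` are reached by moving the first coordinate to `t` with the
    -- second one fixed.
    have key : ∀ t : ℝ, |t| < r → SignType.sign t = ε →
        (W ∩ {z | SignType.sign (Θ z).1 = ε}).Nonempty := by
      intro t ht hε
      have hmem : (t, (Θ y).2) ∈ Metric.ball (Θ y) r := by
        rw [Metric.mem_ball, Prod.dist_eq, h0]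
        simpa [Real.dist_eq, hr] using ht
      refine ⟨Θ.symm (t, (Θ y).2), (hball hmem).2, ?_⟩
      change SignType.sign (Θ (Θ.symm (t, (Θ y).2))).1 = ε
      rw [Θ.right_inv (hball hmem).1, hε]
    have hr2 : |r / 2| < r := by rw [abs_of_pos (half_pos hr)]; exact half_lt_self hr
    rcases SignType.unit_eq_or_eq_neg ε 1 with rfl | rfl
    · exact key (r / 2) hr2 (sign_pos (half_pos hr))
    · exact key (-(r / 2)) (by rwa [abs_neg]) (sign_neg (neg_lt_zero.2 (half_pos hr)))

open Classical in
/-- The chart of `M` given by the second component of slice coordinates. -/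
noncomputable def IsSlice.chart (hΘ : IsSlice M Θ) (p : M) : OpenPartialHomeomorph M K where
  toFun x := (Θ x).2
  -- The value `p` is a default; for `y` in the target the first branch always applies.
  invFun y := if h : Θ.symm (0, y) ∈ M then ⟨_, h⟩ else p
  source := Subtype.val ⁻¹' Θ.source
  target := (fun y => ((0 : ℝ), y)) ⁻¹' Θ.target
  map_source' x hx := by
    have h0 : (Θ x).1 = 0 := (hΘ x hx).1 x.2
    change ((0 : ℝ), (Θ x).2) ∈ Θ.target
    rw [← h0]
    exact Θ.map_source hx
  map_target' y hy := by
    have h : Θ.symm (0, y) ∈ M :=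
      (hΘ _ (Θ.map_target hy)).2 (congrArg Prod.fst (Θ.right_inv hy))
    rw [dif_pos h]
    exact Θ.map_target hy
  left_inv' x hx := by
    have h0 : (Θ x).1 = 0 := (hΘ x hx).1 x.2
    have h : Θ.symm (0, (Θ x).2) = x := by
      rw [← h0]
      exact Θ.left_inv hx
    have h' : Θ.symm (0, (Θ x).2) ∈ M := by
      rw [h]
      exact x.2
    rw [dif_pos h']
    exact Subtype.ext h
  right_inv' y hy := by
    have h : Θ.symm (0, y) ∈ M :=
      (hΘ _ (Θ.map_target hy)).2 (congrArg Prod.fst (Θ.right_inv hy))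
    rw [dif_pos h]
    exact congrArg Prod.snd (Θ.right_inv hy)
  open_source := Θ.open_source.preimage continuous_subtype_val
  open_target := Θ.open_target.preimage (by fun_prop)
  continuousOn_toFun :=
    (Θ.continuousOn.comp continuous_subtype_val.continuousOn fun _ h => h).snd
  continuousOn_invFun := by
    rw [IsInducing.subtypeVal.continuousOn_iff]
    refine ContinuousOn.congr (f := fun y => Θ.symm (0, y)) (Θ.continuousOn_symm.comp
      (by fun_prop) fun _ h => h) fun y hy => ?_
    have h : Θ.symm (0, y) ∈ M :=
      (hΘ _ (Θ.map_target hy)).2 (congrArg Prod.fst (Θ.right_inv hy))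
    rw [Function.comp_apply, dif_pos h]

open Classical in
theorem IsSlice.chart_symm_coe (hΘ : IsSlice M Θ) (p : M) {y : K}
    (hy : ((0 : ℝ), y) ∈ Θ.target) : ((hΘ.chart p).symm y : X) = Θ.symm (0, y) := by
  have h : Θ.symm (0, y) ∈ M :=
    (hΘ _ (Θ.map_target hy)).2 (congrArg Prod.fst (Θ.right_inv hy))
  change ((if h : Θ.symm (0, y) ∈ M then (⟨_, h⟩ : M) else p : M) : X) = _
  rw [dif_pos h]

end Slices

/-! ### Smooth slice coordinates and the charts they induce on `M` -/

section SmoothSlices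

variable {E X : Type*} [NormedAddCommGroup E] [NormedSpace ℝ E] [TopologicalSpace X]
  [ChartedSpace E X] {M : Set X} {m : ℕ}

/-- Slice coordinates that are smooth in both directions. -/
structure IsSmoothSlice (M : Set X)
    (Θ : OpenPartialHomeomorph X (ℝ × EuclideanSpace ℝ (Fin m))) : Prop where
  isSlice : IsSlice M Θ
  contMDiffOn : ContMDiffOn 𝓘(ℝ, E) 𝓘(ℝ, ℝ × EuclideanSpace ℝ (Fin m)) ∞ Θ Θ.source
  contMDiffOn_symm : ContMDiffOn 𝓘(ℝ, ℝ × EuclideanSpace ℝ (Fin m)) 𝓘(ℝ, E) ∞ Θ.symm Θ.target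

variable {Θ Θ' : OpenPartialHomeomorph X (ℝ × EuclideanSpace ℝ (Fin m))}

theorem IsSmoothSlice.restrOpen (h : IsSmoothSlice (E := E) M Θ) {s : Set X} (hs : IsOpen s) :
    IsSmoothSlice (E := E) M (Θ.restrOpen s hs) where
  isSlice x hx := h.isSlice x hx.1
  contMDiffOn := h.contMDiffOn.mono inter_subset_left
  contMDiffOn_symm := h.contMDiffOn_symm.mono inter_subset_left

theorem IsSmoothSlice.transHomeomorph (h : IsSmoothSlice (E := E) M Θ)
    (A : (ℝ × EuclideanSpace ℝ (Fin m)) ≃L[ℝ] (ℝ × EuclideanSpace ℝ (Fin m)))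
    (hA : ∀ z, (A z).1 = 0 ↔ z.1 = 0) :
    IsSmoothSlice (E := E) M (Θ.transHomeomorph A.toHomeomorph) where
  isSlice x hx := (h.isSlice x hx).trans (hA _).symm
  contMDiffOn := A.contDiff.contMDiff.comp_contMDiffOn h.contMDiffOn
  contMDiffOn_symm := h.contMDiffOn_symm.comp A.symm.contDiff.contMDiff.contMDiffOn
    fun _ h => h

/-- The inverse chart has the smooth left inverse `x ↦ (Θ x).2`, so its differential is injective by
the chain rule. -/
theorem IsSmoothSlice.isSubmanifoldChart (h : IsSmoothSlice (E := E) M Θ) (p : M) :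
    IsSubmanifoldChart 𝓘(ℝ, E) (h.isSlice.chart p) := by
  have hinr : ContMDiff 𝓘(ℝ, EuclideanSpace ℝ (Fin m)) 𝓘(ℝ, ℝ × EuclideanSpace ℝ (Fin m)) ∞
      (fun y : EuclideanSpace ℝ (Fin m) => ((0 : ℝ), y)) :=
    (contDiff_const.prodMk contDiff_id).contMDiff
  have hsmooth : ContMDiffOn 𝓘(ℝ, EuclideanSpace ℝ (Fin m)) 𝓘(ℝ, E) ∞
      (fun y => ((h.isSlice.chart p).symm y : X)) (h.isSlice.chart p).target :=
    (h.contMDiffOn_symm.comp hinr.contMDiffOn fun _ h => h).congr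
      fun y hy => h.isSlice.chart_symm_coe p hy
  refine ⟨hsmooth, fun y hy => ?_⟩
  have hnhds : (h.isSlice.chart p).target ∈ 𝓝 y := (h.isSlice.chart p).open_target.mem_nhds hy
  have hcoe : ((h.isSlice.chart p).symm y : X) ∈ Θ.source := (h.isSlice.chart p).map_target hy
  have d1 : MDifferentiableAt 𝓘(ℝ, EuclideanSpace ℝ (Fin m)) 𝓘(ℝ, E)
      (fun y => ((h.isSlice.chart p).symm y : X)) y :=
    (hsmooth.contMDiffAt hnhds).mdifferentiableAt (by simp)
  have d2 : MDifferentiableAt 𝓘(ℝ, E) 𝓘(ℝ, EuclideanSpace ℝ (Fin m)) (fun x => (Θ x).2)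
      ((h.isSlice.chart p).symm y : X) :=
    ((contDiff_snd.contMDiff.comp_contMDiffOn h.contMDiffOn).contMDiffAt
      (Θ.open_source.mem_nhds hcoe)).mdifferentiableAt (by simp)
  have hid : (fun x => (Θ x).2) ∘ (fun y => ((h.isSlice.chart p).symm y : X)) =ᶠ[𝓝 y] id := by
    filter_upwards [hnhds] with z hz
    exact (h.isSlice.chart p).right_inv hz
  have hcomp := mfderiv_comp y d2 d1
  rw [hid.mfderiv_eq, mfderiv_id] at hcomp
  intro v w hvw
  have hv := DFunLike.congr_fun hcomp v
  have hw := DFunLike.congr_fun hcomp w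
  exact hv.trans ((congrArg (mfderiv 𝓘(ℝ, E) 𝓘(ℝ, EuclideanSpace ℝ (Fin m)) (fun x => (Θ x).2)
    ((h.isSlice.chart p).symm y : X)) hvw).trans hw.symm)

/-- A change of slice coordinates is smooth. -/
theorem IsSmoothSlice.contDiffAt_trans (h : IsSmoothSlice (E := E) M Θ)
    (h' : IsSmoothSlice (E := E) M Θ') {z : ℝ × EuclideanSpace ℝ (Fin m)} (hz : z ∈ Θ.target)
    (hz' : Θ.symm z ∈ Θ'.source) : ContDiffAt ℝ ∞ (fun w => Θ' (Θ.symm w)) z := by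
  rw [← contMDiffAt_iff_contDiffAt]
  exact (h'.contMDiffOn.contMDiffAt (Θ'.open_source.mem_nhds hz')).comp z
    (h.contMDiffOn_symm.contMDiffAt (Θ.open_target.mem_nhds hz))

end SmoothSlices

/-- The hypothesis says that `L` preserves `{0} × K`, so its matrix is block lower triangular. -/
theorem LinearMap.det_of_fst_comp_inr_eq_zero {K : Type*} [AddCommGroup K] [Module ℝ K]
    [FiniteDimensional ℝ K] (L : (ℝ × K) →ₗ[ℝ] (ℝ × K)) (hL : ∀ k, (L (0, k)).1 = 0) :
    LinearMap.det L = (L (1, 0)).1 *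
      LinearMap.det (LinearMap.snd ℝ ℝ K ∘ₗ L ∘ₗ LinearMap.inr ℝ ℝ K) := by
  classical
  let b := Module.Basis.singleton Unit ℝ
  let b' := Module.finBasis ℝ K
  have : LinearMap.toMatrix (b.prod b') (b.prod b') L = Matrix.fromBlocks
      (Matrix.of fun _ _ => (L (1, 0)).1) 0 (Matrix.of fun i _ => b'.repr (L (1, 0)).2 i)
      (LinearMap.toMatrix b' b' (LinearMap.snd ℝ ℝ K ∘ₗ L ∘ₗ LinearMap.inr ℝ ℝ K)) := by
    ext i j
    rcases i with i | i <;> rcases j with j | j <;>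
      simp [LinearMap.toMatrix_apply, b, hL]
  rw [← LinearMap.det_toMatrix (b.prod b'), this, Matrix.det_fromBlocks_zero₁₂,
    LinearMap.det_toMatrix]
  simp

/-! ### Jacobians of transitions between charts of `M` -/

section Transition

variable {E X : Type*} [NormedAddCommGroup E] [NormedSpace ℝ E] [TopologicalSpace X]
  [ChartedSpace E X] {M : Set X} {m : ℕ}
  {Θ Θ' : OpenPartialHomeomorph X (ℝ × EuclideanSpace ℝ (Fin m))}

/-- If a change of slice coordinates has positive Jacobian determinant and preserves the sides
of `M`, then the induced change of charts of `M` has positive Jacobian determinant. -/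
theorem IsSmoothSlice.det_fderiv_transition_pos (h : IsSmoothSlice (E := E) M Θ)
    (h' : IsSmoothSlice (E := E) M Θ') {σ : X → SignType}
    (hσ : ∀ x ∈ Θ.source, SignType.sign (Θ x).1 = σ x)
    (hσ' : ∀ x ∈ Θ'.source, SignType.sign (Θ' x).1 = σ x)
    (hpos : ∀ z ∈ Θ.target, Θ.symm z ∈ Θ'.source →
      0 < (fderiv ℝ (fun w => Θ' (Θ.symm w)) z).det) (p p' : M)
    {y : EuclideanSpace ℝ (Fin m)}
    (hy : y ∈ ((h.isSlice.chart p).symm.trans (h'.isSlice.chart p')).source) :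
    0 < (fderiv ℝ ((h.isSlice.chart p).symm.trans (h'.isSlice.chart p')) y).det := by
  have mem : ∀ w ∈ ((h.isSlice.chart p).symm.trans (h'.isSlice.chart p')).source,
      ((0 : ℝ), w) ∈ Θ.target ∧ Θ.symm (0, w) ∈ Θ'.source := by
    rintro w ⟨hw, hw'⟩
    refine ⟨hw, ?_⟩
    rw [← h.isSlice.chart_symm_coe p hw]
    exact hw'
  obtain ⟨hyt, hys⟩ := mem y hy
  set H : ℝ × EuclideanSpace ℝ (Fin m) → ℝ × EuclideanSpace ℝ (Fin m) :=
    fun w => Θ' (Θ.symm w) with hH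
  have hD : HasFDerivAt H (fderiv ℝ H (0, y)) (0, y) :=
    ((h.contDiffAt_trans h' hyt hys).differentiableAt (by simp)).hasFDerivAt
  set L := fderiv ℝ H (0, y)
  have hinr : HasFDerivAt (fun w : EuclideanSpace ℝ (Fin m) => ((0 : ℝ), w))
      (ContinuousLinearMap.inr ℝ ℝ (EuclideanSpace ℝ (Fin m))) y :=
    (ContinuousLinearMap.inr ℝ ℝ (EuclideanSpace ℝ (Fin m))).hasFDerivAt
  have hHinr := hD.comp y hinr
  have hopen := ((h.isSlice.chart p).symm.trans (h'.isSlice.chart p')).open_source.mem_nhds hy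
  have hfd : fderiv ℝ ((h.isSlice.chart p).symm.trans (h'.isSlice.chart p')) y =
      (ContinuousLinearMap.snd ℝ ℝ (EuclideanSpace ℝ (Fin m))).comp
        (L.comp (ContinuousLinearMap.inr ℝ ℝ (EuclideanSpace ℝ (Fin m)))) := by
    refine HasFDerivAt.fderiv (HasFDerivAt.congr_of_eventuallyEq hHinr.snd ?_)
    filter_upwards [hopen] with w hw
    change (Θ' ((h.isSlice.chart p).symm w : X)).2 = _
    rw [h.isSlice.chart_symm_coe p (mem w hw).1]
    rfl
  have hsign : ∀ z ∈ Θ.target, Θ.symm z ∈ Θ'.source →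
      SignType.sign (H z).1 = SignType.sign z.1 := by
    intro z hz hz'
    rw [hH, hσ' _ hz', ← hσ _ (Θ.map_target hz), Θ.right_inv hz]
  have hzero : ∀ k, (L (0, k)).1 = 0 := by
    intro k
    have h1 : HasFDerivAt (fun w => (H (0, w)).1) (0 : EuclideanSpace ℝ (Fin m) →L[ℝ] ℝ) y := by
      refine (hasFDerivAt_const (0 : ℝ) y).congr_of_eventuallyEq ?_
      filter_upwards [hopen] with w hw
      have := hsign _ (mem w hw).1 (mem w hw).2
      rwa [sign_zero, sign_eq_zero_iff] at this
    exact congrArg (fun A => A k) (hHinr.fst.unique h1)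
  -- This entry is the limit as `t → 0⁺` of the slopes of `(H (t, y)).1`, which is positive for `t >
  -- 0` and zero at `0`. Nonnegativity suffices, because the product with the other block's
  -- determinant is positive.
  have hnonneg : 0 ≤ (L (1, 0)).1 := by
    have hline : HasDerivAt (fun t : ℝ => (t, y)) ((1 : ℝ), (0 : EuclideanSpace ℝ (Fin m))) 0 :=
      (hasDerivAt_id (0 : ℝ)).prodMk (hasDerivAt_const 0 y)
    have h1 : HasDerivAt (fun t : ℝ => (H (t, y)).1) (L (1, 0)).1 0 :=
      by
      have := hD.comp_hasDerivAt (0 : ℝ) hline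
      exact (ContinuousLinearMap.fst ℝ ℝ (EuclideanSpace ℝ (Fin m))).hasFDerivAt.comp_hasDerivAt
        (0 : ℝ) this
    refine ge_of_tendsto (h1.tendsto_slope_zero_right) ?_
    have hcont : ContinuousAt (fun t : ℝ => (t, y)) 0 := by fun_prop
    have hev : ∀ᶠ t in 𝓝 (0 : ℝ), (t, y) ∈ Θ.target ∧ Θ.symm (t, y) ∈ Θ'.source :=
      hcont.preimage_mem_nhds (inter_mem (Θ.open_target.mem_nhds hyt)
        ((Θ.continuousAt_symm hyt).preimage_mem_nhds (Θ'.open_source.mem_nhds hys)))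
    have h0 : (H (0, y)).1 = 0 := by
      have := hsign _ hyt hys
      rwa [sign_zero, sign_eq_zero_iff] at this
    filter_upwards [hev.filter_mono nhdsWithin_le_nhds, self_mem_nhdsWithin] with t ht ht0
    have hpos : 0 < (H (t, y)).1 := by
      rw [← sign_eq_one_iff, hsign _ ht.1 ht.2]
      exact sign_pos ht0
    rw [zero_add, h0, sub_zero]
    exact smul_nonneg (inv_nonneg.2 (le_of_lt ht0)) hpos.le
  have hdet := LinearMap.det_of_fst_comp_inr_eq_zero
    (L : (ℝ × EuclideanSpace ℝ (Fin m)) →ₗ[ℝ] (ℝ × EuclideanSpace ℝ (Fin m))) hzero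
  have hL : 0 < L.det := hpos _ hyt hys
  rw [hfd]
  refine pos_of_mul_pos_right ?_ hnonneg
  · exact lt_of_lt_of_eq hL hdet

end Transition

/-! ### Orientation of local coordinates of complex projective space -/

/-- The real determinant is the norm from `ℂ` to `ℝ` of the complex one, that is, its squared
modulus. -/
theorem ContinuousLinearMap.det_restrictScalars_nonneg {V : Type*} [NormedAddCommGroup V]
    [NormedSpace ℂ V] (L : V →L[ℂ] V) : 0 ≤ (L.restrictScalars ℝ).det := by
  have : (L.restrictScalars ℝ).det = LinearMap.det ((L : V →ₗ[ℂ] V).restrictScalars ℝ) := rfl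
  rw [this, LinearMap.det_restrictScalars, Algebra.norm_complex_apply]
  exact Complex.normSq_nonneg _

namespace CP

variable {n : ℕ} {K : Type*} [NormedAddCommGroup K] [NormedSpace ℝ K]
  (J : (ℝ × K) ≃L[ℝ] (Fin n → ℂ))

theorem ofAffine_affineCoord {i : Fin (n + 1)} {x : CP n} (hx : x ∈ affineDomain i) :
    ofAffine i (affineCoord i x) = x :=
  (affineChart i).left_inv hx

theorem contMDiff_ofAffine (i : Fin (n + 1)) :
    ContMDiff 𝓘(ℝ, Fin n → ℂ) 𝓘(ℝ, Fin n → ℂ) ∞ (ofAffine i) := by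
  rw [← contMDiffOn_univ]
  exact contMDiffOn_symm_of_mem_maximalAtlas (e := affineChart i)
    (IsManifold.subset_maximalAtlas (mem_range_self i))

theorem contMDiffOn_affineCoord (i : Fin (n + 1)) :
    ContMDiffOn 𝓘(ℝ, Fin n → ℂ) 𝓘(ℝ, Fin n → ℂ) ∞ (affineCoord i) (affineDomain i) :=
  contMDiffOn_of_mem_maximalAtlas (e := affineChart i)
    (IsManifold.subset_maximalAtlas (mem_range_self i))

theorem differentiableAt_affineCoord_ofAffine {i j : Fin (n + 1)} {w : Fin n → ℂ}
    (hw : ofAffine j w ∈ affineDomain i) :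
    DifferentiableAt ℂ (fun w => affineCoord i (ofAffine j w)) w := by
  have hins : ∀ l : Fin (n + 1), Differentiable ℂ
      (fun w : Fin n → ℂ => (j.insertNth (1 : ℂ) w : Fin (n + 1) → ℂ) l) := by
    intro l
    refine Fin.succAboveCases j ?_ (fun k => ?_) l
    · simp
    · simpa using differentiable_apply k
  refine differentiableAt_pi.2 fun k => ?_
  have h0 : (j.insertNth (1 : ℂ) w : Fin (n + 1) → ℂ) i ≠ 0 := (proj_mem_affineDomain i _).1 hw
  exact (hins (i.succAbove k) w).fun_mul ((hins i w).fun_inv h0)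

/-- The Jacobian determinant of `f` at `x` in the affine coordinates of index `i`, its target
being identified with `ℂ^n` by `J`. -/
noncomputable def jacobian (f : CP n → ℝ × K) (i : Fin (n + 1)) (x : CP n) : ℝ :=
  ((J : (ℝ × K) →L[ℝ] (Fin n → ℂ)).comp
    (fderiv ℝ (fun w => f (ofAffine i w)) (affineCoord i x))).det

variable {J} {f g : CP n → ℝ × K} {x : CP n} {i j : Fin (n + 1)}

theorem contDiffAt_comp_ofAffine (hx : x ∈ affineDomain i)
    (hf : ContMDiffAt 𝓘(ℝ, Fin n → ℂ) 𝓘(ℝ, ℝ × K) ∞ f x) :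
    ContDiffAt ℝ ∞ (fun w => f (ofAffine i w)) (affineCoord i x) := by
  rw [← contMDiffAt_iff_contDiffAt]
  refine ContMDiffAt.comp (affineCoord i x) ?_ (contMDiff_ofAffine i).contMDiffAt
  rwa [ofAffine_affineCoord hx]

/-- The chain rule; conjugating the derivative of `H` by `J` does not change its determinant. -/
theorem jacobian_comp (hx : x ∈ affineDomain i)
    (hf : ContMDiffAt 𝓘(ℝ, Fin n → ℂ) 𝓘(ℝ, ℝ × K) ∞ f x) {H : ℝ × K → ℝ × K}
    (hH : DifferentiableAt ℝ H (f x)) (hg : ∀ᶠ y in 𝓝 x, g y = H (f y)) :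
    jacobian J g i x = (fderiv ℝ H (f x)).det * jacobian J f i x := by
  have hf' := (contDiffAt_comp_ofAffine hx hf).differentiableAt (by simp)
  have hc : ContinuousAt (ofAffine i) (affineCoord i x) :=
    (contMDiff_ofAffine (n := n) i).continuous.continuousAt
  rw [← ofAffine_affineCoord hx] at hg hH
  have heq : (fun w => g (ofAffine i w)) =ᶠ[𝓝 (affineCoord i x)]
      H ∘ fun w => f (ofAffine i w) := hc.eventually hg
  rw [jacobian, jacobian, heq.fderiv_eq, fderiv_comp (affineCoord i x) hH hf', ofAffine_affineCoord hx]
  set D := fderiv ℝ (fun w => f (ofAffine i w)) (affineCoord i x)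
  set L := fderiv ℝ H (f x)
  have h1 : LinearMap.det ((J.toLinearEquiv : (ℝ × K) →ₗ[ℝ] (Fin n → ℂ)) ∘ₗ
      (L : (ℝ × K) →ₗ[ℝ] (ℝ × K)) ∘ₗ (J.toLinearEquiv.symm : (Fin n → ℂ) →ₗ[ℝ] (ℝ × K))) =
      L.det := LinearMap.det_conj (L : (ℝ × K) →ₗ[ℝ] (ℝ × K)) J.toLinearEquiv
  rw [← h1]
  change LinearMap.det _ = LinearMap.det _ * LinearMap.det _
  rw [← map_mul]
  congr 1
  refine LinearMap.ext fun v => ?_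
  simp

/-- Changes of affine coordinates are holomorphic, so their real determinant `d` is nonnegative.
With `jacobian_ne_zero`, the sign of the Jacobian of smooth local coordinates does not depend on the
affine chart. -/
theorem jacobian_eq_mul (hi : x ∈ affineDomain i) (hj : x ∈ affineDomain j)
    (hf : ContMDiffAt 𝓘(ℝ, Fin n → ℂ) 𝓘(ℝ, ℝ × K) ∞ f x) :
    ∃ d : ℝ, 0 ≤ d ∧ jacobian J f j x = jacobian J f i x * d := by
  have hmem : ofAffine j (affineCoord j x) ∈ affineDomain i := by
    rwa [ofAffine_affineCoord hj]
  have hT := differentiableAt_affineCoord_ofAffine hmem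
  refine ⟨_, ContinuousLinearMap.det_restrictScalars_nonneg
    (fderiv ℂ (fun w => affineCoord i (ofAffine j w)) (affineCoord j x)), ?_⟩
  have hTR := hT.hasFDerivAt.restrictScalars ℝ
  have hf' := ((contDiffAt_comp_ofAffine hi hf).differentiableAt (by simp)).hasFDerivAt
  have hpt : affineCoord i (ofAffine j (affineCoord j x)) = affineCoord i x := by
    rw [ofAffine_affineCoord hj]
  rw [← hpt] at hf'
  have hcomp := hf'.comp (affineCoord j x) hTR
  have hc : ContinuousAt (ofAffine j) (affineCoord j x) :=
    (contMDiff_ofAffine (n := n) j).continuous.continuousAt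
  have heq : (fun w => f (ofAffine j w)) =ᶠ[𝓝 (affineCoord j x)]
      (fun w => f (ofAffine i w)) ∘ fun w => affineCoord i (ofAffine j w) := by
    filter_upwards [hc.preimage_mem_nhds ((isOpen_affineDomain i).mem_nhds hmem)] with w hw
    exact congrArg f (ofAffine_affineCoord hw).symm
  rw [jacobian, jacobian, (hcomp.congr_of_eventuallyEq heq).fderiv, hpt]
  change LinearMap.det _ = LinearMap.det _ * LinearMap.det _
  rw [← map_mul]
  rfl

variable {Θ : OpenPartialHomeomorph (CP n) (ℝ × K)}

theorem jacobian_ne_zero (hi : x ∈ affineDomain i) (hx : x ∈ Θ.source)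
    (h : ContMDiffOn 𝓘(ℝ, Fin n → ℂ) 𝓘(ℝ, ℝ × K) ∞ Θ Θ.source)
    (h' : ContMDiffOn 𝓘(ℝ, ℝ × K) 𝓘(ℝ, Fin n → ℂ) ∞ Θ.symm Θ.target) :
    jacobian J Θ i x ≠ 0 := by
  have hf := ((contDiffAt_comp_ofAffine hi
    (h.contMDiffAt (Θ.open_source.mem_nhds hx))).differentiableAt (by simp)).hasFDerivAt
  have hg : DifferentiableAt ℝ (fun z => affineCoord i (Θ.symm z)) (Θ x) := by
    refine ContDiffAt.differentiableAt (n := ∞) ?_ (by simp)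
    rw [← contMDiffAt_iff_contDiffAt]
    refine ContMDiffAt.comp (Θ x) ?_
      (h'.contMDiffAt (Θ.open_target.mem_nhds (Θ.map_source hx)))
    rw [Θ.left_inv hx]
    exact (contMDiffOn_affineCoord i).contMDiffAt ((isOpen_affineDomain i).mem_nhds hi)
  have hc : ContinuousAt (ofAffine i) (affineCoord i x) :=
    (contMDiff_ofAffine (n := n) i).continuous.continuousAt
  have hg' := hg.hasFDerivAt
  have hpt : Θ (ofAffine i (affineCoord i x)) = Θ x := by rw [ofAffine_affineCoord hi]
  rw [← hpt] at hg'
  have hcomp := hg'.comp (affineCoord i x) hf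
  have heq : (fun z => affineCoord i (Θ.symm z)) ∘ (fun w => Θ (ofAffine i w))
      =ᶠ[𝓝 (affineCoord i x)] id := by
    have hx' : ofAffine i (affineCoord i x) ∈ Θ.source := by rwa [ofAffine_affineCoord hi]
    filter_upwards [hc.preimage_mem_nhds (Θ.open_source.mem_nhds hx')] with w hw
    change affineCoord i (Θ.symm (Θ (ofAffine i w))) = w
    rw [Θ.left_inv hw]
    exact (affineChart i).right_inv (mem_univ w)
  have hid := (hcomp.congr_of_eventuallyEq heq.symm).unique (hasFDerivAt_id _)
  set D := fderiv ℝ (fun w => Θ (ofAffine i w)) (affineCoord i x)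
  set G := fderiv ℝ (fun z => affineCoord i (Θ.symm z)) (Θ (ofAffine i (affineCoord i x)))
  have hprod : LinearMap.det ((G.comp (J.symm : (Fin n → ℂ) →L[ℝ] (ℝ × K)) :
      (Fin n → ℂ) →L[ℝ] (Fin n → ℂ)) : (Fin n → ℂ) →ₗ[ℝ] (Fin n → ℂ)) * jacobian J Θ i x = 1 := by
    change LinearMap.det _ * LinearMap.det _ = 1
    rw [← map_mul, ← LinearMap.det_id (A := ℝ) (M := Fin n → ℂ)]
    congr 1
    refine LinearMap.ext fun v => ?_
    have := DFunLike.congr_fun hid v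
    simpa using this
  exact right_ne_zero_of_mul_eq_one hprod

theorem continuousAt_jacobian (hi : x ∈ affineDomain i)
    (hf : ContMDiffAt 𝓘(ℝ, Fin n → ℂ) 𝓘(ℝ, ℝ × K) ∞ f x) :
    ContinuousAt (jacobian J f i) x := by
  have h1 : ContinuousAt (fderiv ℝ (fun w => f (ofAffine i w))) (affineCoord i x) :=
    ((contDiffAt_comp_ofAffine hi hf).fderiv_right (m := ∞) (by simp)).continuousAt
  have h2 : ContinuousAt (affineCoord i) x := (affineChart i).continuousAt hi
  exact ContinuousLinearMap.continuous_det.continuousAt.comp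
    ((ContinuousLinearMap.compL ℝ _ _ _ (J : (ℝ × K) →L[ℝ] (Fin n → ℂ))).continuous.continuousAt.comp
      (h1.comp h2))

variable (J) in
/-- The local coordinates `Θ` are compatible with the complex orientation. -/
def IsPositive (Θ : OpenPartialHomeomorph (CP n) (ℝ × K)) : Prop :=
  ∀ x ∈ Θ.source, ∀ i, x ∈ affineDomain i → 0 < jacobian J Θ i x

end CP

/-! ### Existence of slice coordinates -/

/-- A nonzero linear functional is the first component of a linear isomorphism. -/
theorem ContinuousLinearMap.exists_equiv_prod_fst_eq {E K : Type*} [NormedAddCommGroup E]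
    [NormedSpace ℝ E] [FiniteDimensional ℝ E] [NormedAddCommGroup K] [NormedSpace ℝ K]
    [FiniteDimensional ℝ K] (hd : Module.finrank ℝ E = Module.finrank ℝ K + 1) {l : E →L[ℝ] ℝ}
    (hl : l ≠ 0) : ∃ (L : E →L[ℝ] K) (T : E ≃L[ℝ] ℝ × K), (T : E →L[ℝ] ℝ × K) = l.prod L := by
  have hl' : (l : E →ₗ[ℝ] ℝ) ≠ 0 := fun h => hl (ContinuousLinearMap.coe_injective h)
  have hker : Module.finrank ℝ (LinearMap.ker (l : E →ₗ[ℝ] ℝ)) = Module.finrank ℝ K := by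
    have h1 := LinearMap.finrank_range_add_finrank_ker (l : E →ₗ[ℝ] ℝ)
    rw [LinearMap.range_eq_top.2 (LinearMap.surjective hl'), finrank_top, Module.finrank_self] at h1
    omega
  -- `L` projects onto `ker l` and identifies it with `K`; it is injective on `ker l`, so the pair
  -- `(l, L)` is injective.
  obtain ⟨π, hπ⟩ := LinearMap.exists_leftInverse_of_injective
    (LinearMap.ker (l : E →ₗ[ℝ] ℝ)).subtype (Submodule.ker_subtype _)
  let L : E →ₗ[ℝ] K := (LinearEquiv.ofFinrankEq _ _ hker).toLinearMap ∘ₗ π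
  have hinj : Function.Injective ((l : E →ₗ[ℝ] ℝ).prod L) := by
    rw [← LinearMap.ker_eq_bot, LinearMap.ker_eq_bot']
    intro z hz
    have h1 : l z = 0 := congrArg Prod.fst hz
    have h2 : L z = 0 := congrArg Prod.snd hz
    have h3 : π z = 0 := (LinearEquiv.map_eq_zero_iff _).1 h2
    have h4 := DFunLike.congr_fun hπ ⟨z, h1⟩
    change π z = ⟨z, h1⟩ at h4
    exact congrArg Subtype.val (h4.symm.trans h3)
  let T := LinearEquiv.ofInjectiveOfFinrankEq _ hinj
    (by rw [Module.finrank_prod, Module.finrank_self, hd, add_comm])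
  exact ⟨LinearMap.toContinuousLinearMap L, T.toContinuousLinearEquiv, rfl⟩

/-- The defining function, read in a chart, is completed by linear functions to a map with
invertible derivative at `p`, and the inverse function theorem applies. -/
theorem IsSmoothRealHypersurface.exists_isSmoothSlice {E X : Type*} [NormedAddCommGroup E]
    [NormedSpace ℝ E] [FiniteDimensional ℝ E] [TopologicalSpace X] [ChartedSpace E X]
    [IsManifold 𝓘(ℝ, E) ∞ X] {M : Set X} (hM : IsSmoothRealHypersurface 𝓘(ℝ, E) M) {m : ℕ}
    (hd : Module.finrank ℝ E = m + 1) {p : X} (hp : p ∈ M) :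
    ∃ Θ : OpenPartialHomeomorph X (ℝ × EuclideanSpace ℝ (Fin m)),
      p ∈ Θ.source ∧ IsSmoothSlice (E := E) M Θ := by
  obtain ⟨U, ρ, hU, hpU, hρ, hdρ, hzero⟩ := hM p hp
  set c := chartAt E p
  set f : E → ℝ := fun z => ρ (c.symm z) with hfdef
  set S : Set E := c.target ∩ c.symm ⁻¹' U
  have hS : IsOpen S := c.isOpen_inter_preimage_symm hU
  have hpc : p ∈ c.source := mem_chart_source E p
  have haS : c p ∈ S := ⟨c.map_source hpc, by
    change c.symm (c p) ∈ U
    rwa [c.left_inv hpc]⟩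
  have hf : ContDiffOn ℝ ∞ f S := by
    rw [← contMDiffOn_iff_contDiffOn]
    exact hρ.comp (contMDiffOn_chart_symm.mono inter_subset_left) fun z hz => hz.2
  have hl : fderiv ℝ f (c p) ≠ 0 := by
    have h := hdρ p hpU
    have hdiff : MDifferentiableAt 𝓘(ℝ, E) 𝓘(ℝ, ℝ) ρ p :=
      (hρ.contMDiffAt (hU.mem_nhds hpU)).mdifferentiableAt (by simp)
    rw [hdiff.mfderiv] at h
    simp only [writtenInExtChartAt, Function.comp_def, mfld_simps, fderivWithin_univ] at h
    exact h
  obtain ⟨L, T, hT⟩ := ContinuousLinearMap.exists_equiv_prod_fst_eq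
    (K := EuclideanSpace ℝ (Fin m)) (by simpa using hd) hl
  set F : E → ℝ × EuclideanSpace ℝ (Fin m) := fun z => (f z, L z)
  have hF : ContDiffOn ℝ ∞ F S := hf.prodMk L.contDiff.contDiffOn
  have hFa : HasFDerivAt F (T : E →L[ℝ] ℝ × EuclideanSpace ℝ (Fin m)) (c p) := by
    rw [hT]
    exact (((hf.contDiffAt (hS.mem_nhds haS)).differentiableAt (by simp)).hasFDerivAt).prodMk
      L.hasFDerivAt
  -- On `O` the derivative stays invertible, which makes the local inverse smooth on its whole
  -- domain and not merely at the image of `c p`.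
  set O : Set E := S ∩ fderiv ℝ F ⁻¹'
    range ((↑) : (E ≃L[ℝ] ℝ × EuclideanSpace ℝ (Fin m)) → E →L[ℝ] ℝ × EuclideanSpace ℝ (Fin m))
  have hO : IsOpen O := (hF.continuousOn_fderiv_of_isOpen hS (by simp)).isOpen_inter_preimage hS
    ContinuousLinearEquiv.isOpen
  have haO : c p ∈ O := ⟨haS, T, hFa.fderiv.symm⟩
  have hFat := hF.contDiffAt (hS.mem_nhds haS)
  set e := (hFat.toOpenPartialHomeomorph F hFa (by simp)).restrOpen O hO
  have hes : ∀ z ∈ e.source, z ∈ O := fun z hz => hz.2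
  have hesymm : ContDiffOn ℝ ∞ e.symm e.target := by
    intro y hy
    obtain ⟨T', hT'⟩ := (hes _ (e.map_target hy)).2
    have hyS := hS.mem_nhds (hes _ (e.map_target hy)).1
    refine (e.contDiffAt_symm (f₀' := T') hy ?_ (hF.contDiffAt hyS)).contDiffWithinAt
    rw [hT']
    exact ((hF.contDiffAt hyS).differentiableAt (by simp)).hasFDerivAt
  refine ⟨c.trans e, ⟨hpc, hFat.mem_toOpenPartialHomeomorph_source hFa (by simp), haO⟩, ?_, ?_, ?_⟩
  · rintro x ⟨hxc, hxe⟩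
    have hxU : x ∈ U := by
      have : c.symm (c x) ∈ U := (hes _ hxe).1.2
      rwa [c.left_inv hxc] at this
    change x ∈ M ↔ ρ (c.symm (c x)) = 0
    rw [c.left_inv hxc]
    have := Set.ext_iff.1 hzero x
    simpa [hxU] using this
  · exact (contMDiffOn_iff_contDiffOn.2 (hF.mono fun z hz => (hes z hz).1)).comp
      (contMDiffOn_chart.mono inter_subset_left) fun x hx => hx.2
  · exact contMDiffOn_chart_symm.comp
      ((contMDiffOn_iff_contDiffOn.2 hesymm).mono inter_subset_left) fun y hy => hy.2

/-- The identity or a hyperplane reflection, according to the sign of `a`; in dimension 0 there is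
no reflection. -/
theorem EuclideanSpace.exists_det_mul_pos {m : ℕ} (hm : m ≠ 0) {a : ℝ} (ha : a ≠ 0) :
    ∃ R : EuclideanSpace ℝ (Fin m) ≃L[ℝ] EuclideanSpace ℝ (Fin m),
      0 < LinearMap.det (R : EuclideanSpace ℝ (Fin m) →ₗ[ℝ] EuclideanSpace ℝ (Fin m)) * a := by
  have : NeZero m := ⟨hm⟩
  rcases lt_or_gt_of_ne ha with h | h
  · let v : EuclideanSpace ℝ (Fin m) := EuclideanSpace.single 0 1
    refine ⟨(Submodule.span ℝ {v})ᗮ.reflection.toContinuousLinearEquiv, ?_⟩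
    have h1 : LinearMap.det ((Submodule.span ℝ {v})ᗮ.reflection.toLinearEquiv :
        EuclideanSpace ℝ (Fin m) →ₗ[ℝ] EuclideanSpace ℝ (Fin m)) = -1 := by
      have hv : v ≠ 0 := by simp [v]
      refine (Submodule.det_reflection _).trans ?_
      rw [Submodule.orthogonal_orthogonal, finrank_span_singleton hv, pow_one]
    refine lt_of_lt_of_eq (neg_pos.2 h) ?_
    rw [← neg_one_mul, ← h1]
    rfl
  · exact ⟨ContinuousLinearEquiv.refl ℝ _, (mul_pos one_pos h).trans_eq
      (congrArg (· * a) LinearMap.det_id.symm)⟩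

/-! ### Coordinates adapted to the sides and to the complex orientation -/

namespace CP

variable {n m : ℕ} {M : Set (CP n)} {σ : CP n → SignType}
  (J : (ℝ × EuclideanSpace ℝ (Fin m)) ≃L[ℝ] (Fin n → ℂ))

/-- Slice coordinates whose first coordinate has the sign of `σ`, and which are compatible with
the complex orientation. -/
structure IsAdapted (M : Set (CP n)) (σ : CP n → SignType)
    (Θ : OpenPartialHomeomorph (CP n) (ℝ × EuclideanSpace ℝ (Fin m))) : Prop where
  isSmoothSlice : IsSmoothSlice (E := Fin n → ℂ) M Θ
  sign_eq : ∀ x ∈ Θ.source, SignType.sign (Θ x).1 = σ x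
  isPositive : IsPositive J Θ

/-- A factor `c = ±1` on the first coordinate matches its sign with `σ`. The orientation is then
corrected by `R` on the remaining coordinates alone, which leaves that sign intact and is why `m ≠
0` is needed. -/
theorem exists_isAdapted (hm : m ≠ 0) (hM : IsClosed M) (hT : ∀ x ∈ M, TwoSidedAt M x)
    (hσ : IsSideOn M univ σ) {Θ : OpenPartialHomeomorph (CP n) (ℝ × EuclideanSpace ℝ (Fin m))}
    (hΘ : IsSmoothSlice (E := Fin n → ℂ) M Θ) {p : CP n} (hp : p ∈ Θ.source) :
    ∃ Θ' : OpenPartialHomeomorph (CP n) (ℝ × EuclideanSpace ℝ (Fin m)),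
      p ∈ Θ'.source ∧ IsAdapted J M σ Θ' := by
  obtain ⟨g, hg⟩ := hΘ.isSlice.isSideOn.exists_unit hM hT hσ hp trivial
  obtain ⟨c, hc⟩ : ∃ c : ℝˣ, SignType.sign (c : ℝ) = g := by
    rcases SignType.unit_eq_or_eq_neg g 1 with rfl | rfl
    · exact ⟨1, by simp⟩
    · exact ⟨-1, by simp⟩
  obtain ⟨i, hi⟩ := exists_mem_affineDomain p
  have hsm : ∀ x ∈ Θ.source, ContMDiffAt 𝓘(ℝ, Fin n → ℂ)
      𝓘(ℝ, ℝ × EuclideanSpace ℝ (Fin m)) ∞ Θ x := fun x hx =>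
    hΘ.contMDiffOn.contMDiffAt (Θ.open_source.mem_nhds hx)
  have hjac : (c : ℝ) * jacobian J Θ i p ≠ 0 :=
    mul_ne_zero c.ne_zero (jacobian_ne_zero hi hp hΘ.contMDiffOn hΘ.contMDiffOn_symm)
  obtain ⟨R, hR⟩ := EuclideanSpace.exists_det_mul_pos hm hjac
  let A : (ℝ × EuclideanSpace ℝ (Fin m)) ≃L[ℝ] (ℝ × EuclideanSpace ℝ (Fin m)) :=
    (ContinuousLinearEquiv.unitsEquivAut ℝ c).prodCongr R
  have hA1 : ∀ z, (A z).1 = z.1 * c := fun _ => rfl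
  have hdetA : (A : (ℝ × EuclideanSpace ℝ (Fin m)) →L[ℝ] (ℝ × EuclideanSpace ℝ (Fin m))).det =
      c * LinearMap.det (R : EuclideanSpace ℝ (Fin m) →ₗ[ℝ] EuclideanSpace ℝ (Fin m)) := by
    have h1 := LinearMap.det_prodMap
      ((ContinuousLinearEquiv.unitsEquivAut ℝ c : ℝ ≃L[ℝ] ℝ) : ℝ →ₗ[ℝ] ℝ)
      (R : EuclideanSpace ℝ (Fin m) →ₗ[ℝ] EuclideanSpace ℝ (Fin m))
    rw [LinearMap.det_ring] at h1
    refine Eq.trans h1 ?_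
    simp
  have hΘ1 := hΘ.transHomeomorph A fun z => by
    rw [hA1, mul_eq_zero, or_iff_left c.ne_zero]
  set Θ1 := Θ.transHomeomorph A.toHomeomorph
  have hjac1 : 0 < jacobian J Θ1 i p := by
    rw [jacobian_comp (g := Θ1) (H := A) hi (hsm p hp) A.differentiableAt (Eventually.of_forall fun _ => rfl),
      A.fderiv, hdetA]
    calc 0 < _ := hR
      _ = _ := by ring
  have hcont : ContinuousAt (jacobian J Θ1 i) p :=
    continuousAt_jacobian hi (hΘ1.contMDiffOn.contMDiffAt (Θ1.open_source.mem_nhds hp))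
  -- Both normalizations hold on a neighbourhood of `p`: the sign relation is one of germs, and
  -- positivity of the Jacobian is an open condition.
  obtain ⟨V, hV, hVo, hpV⟩ := mem_nhds_iff.1 (inter_mem (inter_mem hg
    (hcont.eventually_const_lt hjac1)) ((isOpen_affineDomain i).mem_nhds hi))
  refine ⟨Θ1.restrOpen V hVo, ⟨hp, hpV⟩, hΘ1.restrOpen hVo, ?_, ?_⟩
  · rintro x ⟨hx, hxV⟩
    have h1 : σ x = g * SignType.sign (Θ x).1 := (hV hxV).1.1
    change SignType.sign (A (Θ x)).1 = σ x
    rw [hA1, sign_mul, hc, h1, mul_comm]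
  · rintro x ⟨hx, hxV⟩ j hj
    have hxi := (hV hxV).2
    have hpos : 0 < jacobian J Θ1 i x := (hV hxV).1.2
    obtain ⟨d, hd, hjd⟩ := jacobian_eq_mul (J := J) hxi hj
      (hΘ1.contMDiffOn.contMDiffAt (Θ1.open_source.mem_nhds hx))
    refine lt_of_le_of_ne ?_
      (jacobian_ne_zero (J := J) hj hx hΘ1.contMDiffOn hΘ1.contMDiffOn_symm).symm
    exact (mul_nonneg hpos.le hd).trans_eq hjd.symm

variable {J} {Θ Θ' : OpenPartialHomeomorph (CP n) (ℝ × EuclideanSpace ℝ (Fin m))}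

/-- By `jacobian_comp` this determinant is the ratio of two positive Jacobians. -/
theorem IsAdapted.det_fderiv_trans_pos (h : IsAdapted J M σ Θ) (h' : IsAdapted J M σ Θ')
    {z : ℝ × EuclideanSpace ℝ (Fin m)} (hz : z ∈ Θ.target) (hz' : Θ.symm z ∈ Θ'.source) :
    0 < (fderiv ℝ (fun w => Θ' (Θ.symm w)) z).det := by
  obtain ⟨i, hi⟩ := exists_mem_affineDomain (Θ.symm z)
  have hx := Θ.map_target hz
  have hH := (h.isSmoothSlice.contDiffAt_trans h'.isSmoothSlice hz hz').differentiableAt (by simp)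
  rw [← Θ.right_inv hz] at hH ⊢
  have hjac := jacobian_comp (J := J) (g := Θ') hi
    (h.isSmoothSlice.contMDiffOn.contMDiffAt (Θ.open_source.mem_nhds hx)) hH (by
      filter_upwards [Θ.open_source.mem_nhds hx] with y hy
      rw [Θ.left_inv hy])
  refine pos_of_mul_pos_left ?_ (h.isPositive _ hx i hi).le
  exact (h'.isPositive _ hz' i hi).trans_eq hjac

end CP

/-! ### Orientability of `M` and the two components of its complement -/

theorem mainTheorem4 (n : ℕ) (hn : 1 ≤ n) (M : Set (CP n))
    (hM : IsSmoothRealHypersurface 𝓘(ℝ, Fin n → ℂ) M)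
    (hcompact : IsCompact M) (hconn : IsConnected M) :
    IsOrientableSubmanifold 𝓘(ℝ, Fin n → ℂ) (2 * n - 1) M ∧
      Nat.card (ConnectedComponents (Mᶜ : Set (CP n))) = 2 := by
  have hclosed : IsClosed M := hcompact.isClosed
  have hdim : Module.finrank ℝ (Fin n → ℂ) = (2 * n - 1) + 1 := by
    rw [Module.finrank_pi_fintype]
    simp only [Complex.finrank_real_complex, Finset.sum_const, Finset.card_univ, Fintype.card_fin,
      smul_eq_mul]
    omega
  have hslice : ∀ p ∈ M, ∃ Θ : OpenPartialHomeomorph (CP n)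
      (ℝ × EuclideanSpace ℝ (Fin (2 * n - 1))), p ∈ Θ.source ∧
        IsSmoothSlice (E := Fin n → ℂ) M Θ := fun p hp => hM.exists_isSmoothSlice hdim hp
  have hT : ∀ p ∈ M, TwoSidedAt M p := fun p hp => by
    obtain ⟨Θ, hpΘ, hΘ⟩ := hslice p hp
    exact hΘ.isSlice.twoSidedAt hpΘ
  obtain ⟨σ, hσ⟩ := CP.exists_isSideOn_univ hclosed hT fun p hp => by
    obtain ⟨Θ, hpΘ, hΘ⟩ := hslice p hp
    exact ⟨⟨(Θ.source, fun x => SignType.sign (Θ x).1), hΘ.isSlice.isSideOn⟩, hpΘ⟩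
  refine ⟨?_, hσ.card_connectedComponents_compl hclosed hT hconn⟩
  -- Any real linear identification will do: another choice multiplies all Jacobians by one nonzero
  -- constant.
  let J : (ℝ × EuclideanSpace ℝ (Fin (2 * n - 1))) ≃L[ℝ] (Fin n → ℂ) :=
    ContinuousLinearEquiv.ofFinrankEq (by
      rw [hdim, Module.finrank_prod, Module.finrank_self, finrank_euclideanSpace_fin, add_comm])
  refine ⟨{φ | ∃ (Θ : OpenPartialHomeomorph (CP n) (ℝ × EuclideanSpace ℝ (Fin (2 * n - 1))))
    (h : CP.IsAdapted J M σ Θ) (p : M), φ = h.isSmoothSlice.isSlice.chart p}, ?_, ?_, ?_⟩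
  · rintro _ ⟨Θ, h, p, rfl⟩
    exact h.isSmoothSlice.isSubmanifoldChart p
  · intro p
    obtain ⟨Θ, hpΘ, hΘ⟩ := hslice p p.2
    obtain ⟨Θ', hpΘ', hΘ'⟩ := CP.exists_isAdapted J (by omega) hclosed hT hσ hΘ hpΘ
    exact ⟨_, ⟨Θ', hΘ', p, rfl⟩, hpΘ'⟩
  · rintro _ ⟨Θ, h, p, rfl⟩ _ ⟨Θ', h', p', rfl⟩ y hy
    exact h.isSmoothSlice.det_fderiv_transition_pos h'.isSmoothSlice h.sign_eq h'.sign_eq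
      (fun z hz hz' => h.det_fderiv_trans_pos h' hz hz') p p' hy
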